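/- **Notation.** $\mathbb Y$ is the Young graph: its vertices are all Young diagrams (including $\varnothing$), and $\mu\nearrow\lambda$ means that $\lambda$ is obtained from $\mu$ by adding one box; $|\lambda|$ is the number of boxes of $\lambda$, $d(\lambda)$ the number of its diagonal boxes, and $\dim\lambda$ the number of paths $\varnothing\nearrow\dots\nearrow\lambda$. A *coherent system* is a function $M\ge 0$ on Young diagrams with $M(\varnothing)=1$ and $$\frac{M(\mu)}{\dim\mu}=\sum_{\lambda:\,\mu\nearrow\lambda}\frac{M(\lambda)}{\dim\lambda}\qquad\text{for all }\mu .$$ For $r_1,\dots,r_n\ge 1$ with $r_1+\dots+r_n=|\lambda|$, $\chi^\lambda_{(r_1,\dots,r_n)}$ is the value of the irreducible character of the symmetric group of degree $|\lambda|$ indexed by $\lambda$ at any permutation with $n$ cycles of lengths $r_1,\dots,r_n$. The Thoma simplex $\Omega$ is the set of triples $\omega=(\alpha,\beta,\gamma)$ with $\alpha_1\ge\alpha_2\ge\dots\ge0$, $\beta_1\ge\beta_2\ge\dots\ge0$, $\gamma\ge0$ and $\sum_i(\alpha_i+\beta_i)+\gamma=1$, with the weakest topology making all $\alpha_i,\beta_i$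 continuous and its Borel $\sigma$-algebra. Put $\widetilde p_1(\omega)=\sum_i\alpha_i+\sum_i\beta_i+\gamma\ (=1)$ and $\widetilde p_k(\omega)=\sum_i\alpha_i^k+(-1)^{k-1}\sum_i\beta_i^k$ for $k\ge2$. For an element $f$ of the algebra $\Lambda=\mathbb R[p_1,p_2,\dots]$ of symmetric functions, $\widetilde f$ is the function on $\Omega$ obtained by replacing each $p_k$ by $\widetilde p_k$; in particular $\widetilde s_\lambda$ comes from the Schur function $s_\lambda=\det[h_{\lambda_i-i+j}]_{i,j=1}^{\ell(\lambda)}$, where $\ell(\lambda)$ is the number of rows of $\lambda$, $\sum_{n\ge0}h_nt^n=\exp\big(\sum_{n\ge1}\tfrac{p_n}{n}t^n\big)$ and $h_m=0$ for $m<0$. A probability measure $P$ on $\Omega$ is the *spectral measure* of $M$ if $M(\lambda)/\dim\lambda=\int_\Omega\widetilde s_\lambda\,dP$ for all $\lambda$. For $\omega\in\Omega$ let $\nu_\omega=\sum_i\alpha_i\,\delta(\alpha_i)+\sum_i\beta_i\,\delta(-\beta_i)+\gamma\,\delta(0)$, a measure on $[-1,1]$. The $n$-th *controlling measure* of $P$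 is the measure $\sigma_n=\int_\Omega\nu_\omega^{\times n}\,P(d\omega)$ on $[-1,1]^n$. **Proposition 3.2.** Let $M$ be a coherent system on the Young graph, $P$ its spectral measure on $\Omega$, and $\sigma_n$ the $n$-th controlling measure of $P$. Then $\sigma_n$ is a probability measure, and for all $l_1,\dots,l_n\in\{0,1,2,\dots\}$ $$\int_{[-1,1]^n}x_1^{l_1}\cdots x_n^{l_n}\,\sigma_n(dx_1\cdots dx_n)=\int_\Omega\widetilde p_{l_1+1}(\omega)\cdots\widetilde p_{l_n+1}(\omega)\,P(d\omega) =\sum_{\substack{\lambda:\ d(\lambda)\le n\\ |\lambda|=l_1+\dots+l_n+n}}\chi^\lambda_{(l_1+1,\dots,l_n+1)}\,\frac{M(\lambda)}{\dim\lambda}.$$ Consequently $\sigma_n$ is determined by the restriction of $M$ to the diagrams with at most $n$ diagonal boxes: if $M'$ is another coherent system, with spectral measure $P'$, and $M'(\lambda)=M(\lambda)$ whenever $d(\lambda)\le n$, then the $n$-th controlling measures of $P'$ and $P$ coincide. -/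

import Mathlib

open MeasureTheory

noncomputable section

/-! ### The Young graph -/

namespace YoungGraph

/-- The edge relation `μ ↗ lam`: the diagram `lam` contains `μ` and has exactly one more box. -/
def Edge (μ lam : YoungDiagram) : Prop :=
  μ ≤ lam ∧ lam.card = μ.card + 1

/-- The dimension of a diagram: the number of oriented paths in the Young graph from the empty
diagram to `lam`.  Every edge adds one box, so such a path has `|lam|` edges. -/
def dim (lam : YoungDiagram) : ℕ :=
  Nat.card {f : Fin (lam.card + 1) → YoungDiagram //
    f 0 = ⊥ ∧ f (Fin.last _) = lam ∧ ∀ i : Fin lam.card, Edge (f i.castSucc) (f i.succ)}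

/-- There are only finitely many diagrams with `n` boxes. -/
theorem finite_level (n : ℕ) : {lam : YoungDiagram | lam.card = n}.Finite := by
  apply Set.Finite.of_finite_image (f := YoungDiagram.cells)
  · apply (Finset.finite_toSet (Finset.range n ×ˢ Finset.range n).powerset).subset
    rintro _ ⟨lam, hl, rfl⟩
    have hl' : lam.cells.card = n := hl
    simp only [Finset.coe_powerset, Set.mem_preimage, Set.mem_powerset_iff, Finset.coe_subset]
    rintro ⟨i, j⟩ hc
    have hc' : (i, j) ∈ lam := hc
    rw [Finset.mem_product, Finset.mem_range, Finset.mem_range]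
    constructor
    · have h1 : i < lam.colLen j := YoungDiagram.mem_iff_lt_colLen.1 hc'
      have h2 : lam.colLen j ≤ lam.cells.card := by
        rw [YoungDiagram.colLen_eq_card]
        exact Finset.card_le_card (Finset.filter_subset _ _)
      simp only
      omega
    · have h1 : j < lam.rowLen i := YoungDiagram.mem_iff_lt_rowLen.1 hc'
      have h2 : lam.rowLen i ≤ lam.cells.card := by
        rw [YoungDiagram.rowLen_eq_card]
        exact Finset.card_le_card (Finset.filter_subset _ _)
      simp only
      omega
  · intro a _ b _ h
    exact YoungDiagram.ext h

/-- The `n`-th floor of the Young graph: the finite set of diagrams with `n` boxes. -/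
def level (n : ℕ) : Finset YoungDiagram := (finite_level n).toFinset

theorem mem_level {n : ℕ} {lam : YoungDiagram} : lam ∈ level n ↔ lam.card = n := by
  simp [level]

open Classical in
/-- A coherent system of distributions on the Young graph: a nonnegative function `M` on diagrams
with `M ∅ = 1` such that `M lam / dim lam` is harmonic. -/
structure IsCoherentSystem (M : YoungDiagram → ℝ) : Prop where
  nonneg : ∀ lam, 0 ≤ M lam
  normalized : M ⊥ = 1
  harmonic : ∀ μ : YoungDiagram,
    M μ / (dim μ : ℝ) = ∑ lam ∈ (level (μ.card + 1)).filter (fun lam => Edge μ lam),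
      M lam / (dim lam : ℝ)

/-- The number `d(lam)` of diagonal boxes. -/
def diagLen (lam : YoungDiagram) : ℕ := (lam.cells.filter (fun c => c.1 = c.2)).card

end YoungGraph

/-! ### Irreducible characters of the symmetric groups -/

namespace SymmetricGroup

/-- The symmetric group of degree `|lam|`, realized as the group of permutations of the boxes of
the diagram `lam`. -/
abbrev BoxPerm (lam : YoungDiagram) : Type := Equiv.Perm lam.cells

open Classical in
/-- The row symmetrizer: the sum of the permutations which preserve each row. -/
def rowSymmetrizer (lam : YoungDiagram) : MonoidAlgebra ℝ (BoxPerm lam) :=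
  ∑ g ∈ (Finset.univ : Finset (BoxPerm lam)).filter
      (fun g => ∀ c : lam.cells, (g c).1.1 = c.1.1),
    MonoidAlgebra.of ℝ _ g

open Classical in
/-- The column antisymmetrizer: the signed sum of the permutations which preserve each column. -/
def colAntisymmetrizer (lam : YoungDiagram) : MonoidAlgebra ℝ (BoxPerm lam) :=
  ∑ g ∈ (Finset.univ : Finset (BoxPerm lam)).filter
      (fun g => ∀ c : lam.cells, (g c).1.2 = c.1.2),
    ((Equiv.Perm.sign g : ℤ) : ℝ) • MonoidAlgebra.of ℝ _ g

/-- The Young symmetrizer of the diagram `lam`. -/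
def youngSymmetrizer (lam : YoungDiagram) : MonoidAlgebra ℝ (BoxPerm lam) :=
  rowSymmetrizer lam * colAntisymmetrizer lam

/-- The Specht module: the left ideal of the group algebra generated by the Young symmetrizer.
It is the irreducible module indexed by `lam`; it is absolutely irreducible, so its character is
the same over `ℝ` and over `ℂ`. -/
def spechtModule (lam : YoungDiagram) : Submodule ℝ (MonoidAlgebra ℝ (BoxPerm lam)) :=
  LinearMap.range (LinearMap.mulRight ℝ (youngSymmetrizer lam))

theorem mul_mem_spechtModule (lam : YoungDiagram) (y : MonoidAlgebra ℝ (BoxPerm lam)) :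
    ∀ x ∈ spechtModule lam, LinearMap.mulLeft ℝ y x ∈ spechtModule lam := by
  rintro _ ⟨z, rfl⟩
  exact ⟨y * z, by simp [mul_assoc]⟩

/-- The representation of the symmetric group on the Specht module, by left multiplication. -/
def spechtRep (lam : YoungDiagram) : Representation ℝ (BoxPerm lam) (spechtModule lam) where
  toFun g := (LinearMap.mulLeft ℝ (MonoidAlgebra.of ℝ (BoxPerm lam) g)).restrict
    (mul_mem_spechtModule lam _)
  map_one' := by
    ext x
    simp [LinearMap.restrict_apply]
  map_mul' g h := by
    apply LinearMap.ext
    intro x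
    apply Subtype.ext
    simp only [LinearMap.restrict_apply, map_mul, LinearMap.mulLeft_apply, Module.End.mul_apply,
      mul_assoc]

/-- The irreducible character `χ^lam`. -/
def irrChar (lam : YoungDiagram) (g : BoxPerm lam) : ℝ := (spechtRep lam).character g

open Classical in
/-- The value `χ^lam_r` of the irreducible character `χ^lam` at any permutation whose multiset of
cycle lengths (fixed points included) is `r`; used only when `r` consists of positive numbers with
sum `|lam|` (it is set to `0` if there is no such permutation). -/
def irrCharAt (lam : YoungDiagram) (r : Multiset ℕ) : ℝ :=
  if h : ∃ g : BoxPerm lam, g.partition.parts = r then irrChar lam h.choose else 0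

/-- The value at a cycle type is the value at any permutation of this cycle type. -/
theorem irrCharAt_eq (lam : YoungDiagram) (g : BoxPerm lam) :
    irrCharAt lam g.partition.parts = irrChar lam g := by
  have h : ∃ k : BoxPerm lam, k.partition.parts = g.partition.parts := ⟨g, rfl⟩
  rw [irrCharAt, dif_pos h]
  obtain ⟨k, hk⟩ := isConj_iff.1
    (Equiv.Perm.partition_eq_of_isConj.2 (Nat.Partition.ext h.choose_spec))
  exact ((spechtRep lam).char_conj _ k).symm.trans (congrArg _ hk)

end SymmetricGroup

/-! ### Symmetric functions -/

/-- The algebra `Λ = ℝ[p₁, p₂, …]` of symmetric functions; the variable `X k` is the power sum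
`p_{k+1}`. -/
abbrev SymFun : Type := MvPolynomial ℕ ℝ

namespace SymFun

/-- The series `∑_{n ≥ 1} (p_n / n) t^n`. -/
def powerSumSeries : PowerSeries SymFun :=
  PowerSeries.mk fun n =>
    if n = 0 then 0 else MvPolynomial.C (1 / (n : ℝ)) * MvPolynomial.X (n - 1)

/-- The complete symmetric functions, `∑_n h_n t^n = exp (∑_{n ≥ 1} (p_n / n) t^n)`. -/
def complete (n : ℕ) : SymFun :=
  PowerSeries.coeff n ((PowerSeries.exp SymFun).subst powerSumSeries)

/-- `h_m` for an integer `m`, with `h_m = 0` for `m < 0`. -/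
def completeInt (m : ℤ) : SymFun := if m < 0 then 0 else complete m.toNat

/-- The Schur function `s_lam = det [h_{lam_i - i + j}]`, of order `ℓ(lam)`. -/
def schur (lam : YoungDiagram) : SymFun :=
  Matrix.det (Matrix.of fun i j : Fin (lam.colLen 0) =>
    completeInt ((lam.rowLen i : ℤ) - (i : ℤ) + (j : ℤ)))

end SymFun

/-! ### The Thoma simplex -/

/-- The Thoma simplex `Ω`: triples `(α, β, γ)` with `α₁ ≥ α₂ ≥ … ≥ 0`, `β₁ ≥ β₂ ≥ … ≥ 0`, `γ ≥ 0`
and `∑ (α_i + β_i) + γ = 1` (sequences are indexed from `0`). -/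
@[ext]
structure ThomaSimplex where
  α : ℕ → ℝ
  β : ℕ → ℝ
  γ : ℝ
  α_anti : Antitone α
  β_anti : Antitone β
  α_nonneg : ∀ i, 0 ≤ α i
  β_nonneg : ∀ i, 0 ≤ β i
  γ_nonneg : 0 ≤ γ
  hasSum : HasSum (fun i => α i + β i) (1 - γ)

namespace ThomaSimplex

/-- The weakest topology in which the coordinates `α_i` and `β_i` are continuous. -/
instance : TopologicalSpace ThomaSimplex :=
  TopologicalSpace.induced (fun ω => (ω.α, ω.β)) inferInstance

instance : MeasurableSpace ThomaSimplex := borel ThomaSimplex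

instance : BorelSpace ThomaSimplex := ⟨rfl⟩

theorem add_le_one (ω : ThomaSimplex) (i : ℕ) : ω.α i + ω.β i ≤ 1 := by
  have h := le_hasSum ω.hasSum i fun j _ => add_nonneg (ω.α_nonneg j) (ω.β_nonneg j)
  have := ω.γ_nonneg
  linarith

/-- The extended power sums `p̃_n`, for `n ≥ 1`. -/
def extPowerSum (n : ℕ) (ω : ThomaSimplex) : ℝ :=
  if n = 1 then (∑' i, ω.α i) + (∑' i, ω.β i) + ω.γ
  else (∑' i, ω.α i ^ n) + (-1) ^ (n - 1) * ∑' i, ω.β i ^ n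

/-- The extended version `f̃` of a symmetric function `f`: replace each `p_n` by `p̃_n`. -/
def extend (f : SymFun) (ω : ThomaSimplex) : ℝ :=
  MvPolynomial.aeval (fun k => extPowerSum (k + 1) ω) f

/-- The point `α_i` of `[-1, 1]`. -/
def posPoint (ω : ThomaSimplex) (i : ℕ) : Set.Icc (-1 : ℝ) 1 :=
  ⟨ω.α i, by have := ω.α_nonneg i; linarith,
    by have := ω.β_nonneg i; have := ω.add_le_one i; linarith⟩

/-- The point `-β_i` of `[-1, 1]`. -/
def negPoint (ω : ThomaSimplex) (i : ℕ) : Set.Icc (-1 : ℝ) 1 :=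
  ⟨-ω.β i, by have := ω.α_nonneg i; have := ω.add_le_one i; linarith,
    by have := ω.β_nonneg i; linarith⟩

/-- The Thoma measure `ν_ω = ∑ α_i δ(α_i) + ∑ β_i δ(-β_i) + γ δ(0)` on `[-1, 1]`. -/
def thomaMeasure (ω : ThomaSimplex) : Measure (Set.Icc (-1 : ℝ) 1) :=
  Measure.sum (fun i => ENNReal.ofReal (ω.α i) • Measure.dirac (ω.posPoint i))
    + Measure.sum (fun i => ENNReal.ofReal (ω.β i) • Measure.dirac (ω.negPoint i))
    + ENNReal.ofReal ω.γ • Measure.dirac ⟨0, by norm_num⟩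

/-- The `n`-th controlling measure `σ_n = ∫_Ω ν_ω × ⋯ × ν_ω P(dω)` on `[-1, 1]^n`. -/
def controllingMeasure (P : Measure ThomaSimplex) (n : ℕ) :
    Measure (Fin n → Set.Icc (-1 : ℝ) 1) :=
  P.bind fun ω => Measure.pi fun _ : Fin n => thomaMeasure ω

end ThomaSimplex

/-- `P` is the spectral measure of `M`: a probability measure on the Thoma simplex such that
`M(lam) / dim lam = ∫ s̃_lam dP` for all diagrams `lam`. -/
structure IsSpectralMeasure (M : YoungDiagram → ℝ) (P : Measure ThomaSimplex) : Prop where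
  isProb : IsProbabilityMeasure P
  repr : ∀ lam : YoungDiagram,
    M lam / (YoungGraph.dim lam : ℝ) = ∫ ω, ThomaSimplex.extend (SymFun.schur lam) ω ∂P

end

/-!
The power sum moments of `ν_ω` are `∫ x ^ l dν_ω = p̃_{l+1}(ω)`, so the moments of `σ_n` are the
integrals of products of `n` extended power sums.  The Frobenius formula `p_ρ = ∑ χ^λ_ρ s_λ`
expresses them through the integrals of the `s̃_λ`, that is, through `M`.  Only the `λ` with
`d(λ) ≤ n` occur: the first `d(λ)` rows of the Jacobi–Trudi matrix consist of elements without
constant term, so `s_λ` lies in the `d(λ)`-th power of the ideal of the power sums and is orthogonal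
to every product of fewer than `d(λ)` of them.  Finally, a finite measure on a cube is determined by
its moments.

For the Frobenius formula, the Frobenius characteristic of the Specht character is identified with
`s_λ`.  Jacobi–Trudi determinants are orthonormal, and the characteristic also has norm one, so it
suffices to compute one pairing.  The pairing with a product of complete functions counts the
invariants of a Young subgroup, which vanish for all terms of the determinant but the diagonal one
by the triangularity of Young symmetrizers.
-/

noncomputable section

namespace SymFun

open MvPolynomial

/-! ### Complete symmetric functions in terms of power sums -/

theorem constantCoeff_powerSumSeries : PowerSeries.constantCoeff powerSumSeries = 0 := by
  rw [← PowerSeries.coeff_zero_eq_constantCoeff_apply]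
  simp [powerSumSeries]

theorem hasSubst_powerSumSeries : PowerSeries.HasSubst powerSumSeries :=
  PowerSeries.HasSubst.of_constantCoeff_zero' constantCoeff_powerSumSeries

theorem coeff_derivative_powerSumSeries (n : ℕ) :
    PowerSeries.coeff n (PowerSeries.derivative SymFun powerSumSeries) = X n := by
  have hn : (n : ℝ) + 1 ≠ 0 := by positivity
  have hC : (n : SymFun) + 1 = C ((n : ℝ) + 1) := by simp
  rw [PowerSeries.coeff_derivative, powerSumSeries, PowerSeries.coeff_mk, if_neg n.succ_ne_zero,
    hC, mul_right_comm, ← C_mul]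
  simp [hn]

theorem complete_zero : complete 0 = 1 := by
  have hsub : (PowerSeries.exp SymFun).subst powerSumSeries
      = (PowerSeries.exp SymFun - 1).subst powerSumSeries + 1 := by
    rw [← PowerSeries.coe_substAlgHom hasSubst_powerSumSeries]
    simp
  have hzero : PowerSeries.constantCoeff ((PowerSeries.exp SymFun - 1).subst powerSumSeries) = 0 :=
    PowerSeries.constantCoeff_subst_eq_zero constantCoeff_powerSumSeries _ (by simp)
  rw [complete, PowerSeries.coeff_zero_eq_constantCoeff_apply, hsub, map_add, hzero]
  simp

/-- Newton's identities, obtained by comparing coefficients in `H' = P' H`. -/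
theorem newton (n : ℕ) :
    ((n : SymFun) + 1) * complete (n + 1) =
      ∑ r ∈ Finset.range (n + 1), X r * complete (n - r) := by
  have h := congrArg (PowerSeries.coeff n)
    (PowerSeries.derivative_subst (f := PowerSeries.exp SymFun) hasSubst_powerSumSeries)
  rw [PowerSeries.derivative_exp, PowerSeries.coeff_derivative, mul_comm (PowerSeries.subst _ _),
    PowerSeries.coeff_mul, Finset.Nat.sum_antidiagonal_eq_sum_range_succ_mk] at h
  simp only [coeff_derivative_powerSumSeries] at h
  rw [mul_comm]
  exact h

/-- The weighted degree of the monomial `∏ X k ^ m k`, in which `X k = p_{k+1}` has degree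
`k + 1`. -/
abbrev wt : (ℕ →₀ ℕ) →+ ℕ := Finsupp.weight fun k : ℕ => k + 1

theorem wt_single (r a : ℕ) : wt (Finsupp.single r a) = a * (r + 1) := by
  simp [Finsupp.weight_single]

theorem wt_eq_zero {m : ℕ →₀ ℕ} : wt m = 0 ↔ m = 0 :=
  have := Finsupp.nonTorsionWeight_of (R := ℕ) (w := fun k : ℕ => k + 1) Nat.succ_ne_zero
  Finsupp.weight_eq_zero_iff_eq_zero _

theorem lt_wt_of_mem_support {m : ℕ →₀ ℕ} {r : ℕ} (h : r ∈ m.support) : r < wt m :=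
  Finsupp.le_weight_of_ne_zero (w := fun k => k + 1) (fun k => (k + 1).zero_le)
    (Finsupp.mem_support_iff.1 h)

/-- The number `z = ∏ (k+1)^{m_k} m_k!`, the order of the centralizer of a permutation with `m_k`
cycles of length `k + 1` for each `k`. -/
def zee (m : ℕ →₀ ℕ) : ℝ := m.prod fun k a => ((k : ℝ) + 1) ^ a * (a.factorial : ℝ)

theorem zee_pos (m : ℕ →₀ ℕ) : 0 < zee m :=
  Finset.prod_pos fun k _ => by positivity

theorem zee_zero : zee 0 = 1 := by simp [zee]

theorem zee_add_single (m : ℕ →₀ ℕ) (r : ℕ) :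
    zee (m + Finsupp.single r 1) = zee m * (((r : ℝ) + 1) * ((m r : ℝ) + 1)) := by
  have herase : (m + Finsupp.single r 1).erase r = m.erase r := by simp [Finsupp.erase_add]
  rw [zee, zee, ← Finsupp.mul_prod_erase' (m + Finsupp.single r 1) r _ (by simp),
    ← Finsupp.mul_prod_erase' m r _ (by simp), herase, Finsupp.add_apply, Finsupp.single_eq_same,
    Nat.factorial_succ, pow_succ]
  push_cast
  ring

theorem coeff_X_mul_of_coeff_eq {f : SymFun} {n : ℕ}
    (hf : ∀ m, coeff m f = if wt m = n then (zee m)⁻¹ else 0) (r : ℕ) (m : ℕ →₀ ℕ) :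
    coeff m (X r * f) = if wt m = n + (r + 1) then ((r : ℝ) + 1) * m r * (zee m)⁻¹ else 0 := by
  rw [coeff_X_mul']
  by_cases hr : m r = 0
  · simp [hr]
  obtain ⟨m, rfl⟩ : ∃ m', m = m' + Finsupp.single r 1 :=
    ⟨_, (Finsupp.sub_add_single_one_cancel hr).symm⟩
  have hz := (zee_pos m).ne'
  have hr₁ : (r : ℝ) + 1 ≠ 0 := by positivity
  have hm₁ : (m r : ℝ) + 1 ≠ 0 := by positivity
  rw [if_pos (Finsupp.mem_support_iff.2 hr), add_tsub_cancel_right, hf, zee_add_single, map_add,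
    wt_single, one_mul]
  simp only [add_left_inj, Finsupp.add_apply, Finsupp.single_eq_same, Nat.cast_add, Nat.cast_one]
  split_ifs
  · field_simp
  · rfl

theorem sum_range_wt (m : ℕ →₀ ℕ) : ∑ r ∈ Finset.range (wt m), ((r : ℝ) + 1) * m r = wt m := by
  conv_rhs => rw [Finsupp.weight_apply, Finsupp.sum_of_support_subset m
    (fun r hr => Finset.mem_range.2 (lt_wt_of_mem_support hr)) _ (by simp)]
  simp only [smul_eq_mul, Nat.cast_sum, Nat.cast_mul, Nat.cast_add, Nat.cast_one, mul_comm]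

theorem coeff_complete (n : ℕ) (m : ℕ →₀ ℕ) :
    coeff m (complete n) = if wt m = n then (zee m)⁻¹ else 0 := by
  induction n using Nat.strong_induction_on generalizing m with
  | _ n ih =>
  rcases n with _ | n
  · simp only [complete_zero, coeff_one, wt_eq_zero, eq_comm (a := (0 : ℕ →₀ ℕ))]
    split_ifs with h
    · rw [h, zee_zero, inv_one]
    · rfl
  have hnewton : ((n : ℝ) + 1) * coeff m (complete (n + 1)) =
      ∑ r ∈ Finset.range (n + 1),
        if wt m = n + 1 then ((r : ℝ) + 1) * m r * (zee m)⁻¹ else 0 := by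
    have hC : (n : SymFun) + 1 = C ((n : ℝ) + 1) := by simp
    rw [← coeff_C_mul, ← hC, newton, coeff_sum]
    refine Finset.sum_congr rfl fun r hr => ?_
    have hr : r < n + 1 := Finset.mem_range.1 hr
    rw [coeff_X_mul_of_coeff_eq (ih (n - r) (by omega)), show n - r + (r + 1) = n + 1 by omega]
  apply mul_left_cancel₀ (show (n : ℝ) + 1 ≠ 0 by positivity)
  rw [hnewton]
  split_ifs with hw
  · rw [← Finset.sum_mul, ← hw, sum_range_wt, hw]
    push_cast
    rfl
  · simp

/-! ### The Hall inner product -/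

/-- The Hall inner product, for which the monomials `p^m` are orthogonal of square norm `z_m`. -/
def pairing : SymFun →ₗ[ℝ] SymFun →ₗ[ℝ] ℝ :=
  (basisMonomials ℕ ℝ).constr ℝ fun m => zee m • lcoeff ℝ m

theorem pairing_monomial (m : ℕ →₀ ℕ) (a : ℝ) (g : SymFun) :
    pairing (monomial m a) g = a * (zee m * coeff m g) := by
  have h : (monomial m a : SymFun) = a • basisMonomials ℕ ℝ m := by
    rw [coe_basisMonomials, smul_monomial, smul_eq_mul, mul_one]
  rw [h, map_smul, pairing, Module.Basis.constr_basis]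
  simp

theorem pairing_eq_sum (f g : SymFun) :
    pairing f g = ∑ m ∈ f.support, zee m * coeff m f * coeff m g := by
  conv_lhs => rw [f.as_sum]
  rw [map_sum, LinearMap.sum_apply]
  refine Finset.sum_congr rfl fun m _ => ?_
  rw [pairing_monomial]
  ring

theorem pairing_comm (f g : SymFun) : pairing f g = pairing g f := by
  classical
  have h : ∀ f g : SymFun, pairing f g =
      ∑ m ∈ f.support ∪ g.support, zee m * coeff m f * coeff m g := by
    intro f g
    rw [pairing_eq_sum]
    refine Finset.sum_subset Finset.subset_union_left fun m _ hm => ?_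
    rw [notMem_support_iff.1 hm]
    simp
  rw [h f g, h g f, Finset.union_comm]
  exact Finset.sum_congr rfl fun m _ => by ring

theorem eq_zero_of_pairing_self {f : SymFun} (h : pairing f f = 0) : f = 0 := by
  rw [pairing_eq_sum, Finset.sum_eq_zero_iff_of_nonneg fun m _ => by
    rw [mul_assoc]
    exact mul_nonneg (zee_pos m).le (mul_self_nonneg _)] at h
  by_contra hf
  obtain ⟨m, hm⟩ := support_nonempty.2 hf
  simpa [mul_assoc, (zee_pos m).ne', mem_support_iff.1 hm] using h m hm

theorem pairing_X_mul (r : ℕ) (f g : SymFun) :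
    pairing (X r * f) g = pairing f (((r : ℝ) + 1) • pderiv r g) := by
  induction f using MvPolynomial.induction_on' with
  | monomial m a =>
    rw [mul_comm, ← pow_one (X r), ← monomial_add_single, pairing_monomial, pairing_monomial,
      zee_add_single, coeff_smul, coeff_pderiv, smul_eq_mul]
    ring
  | add p q hp hq => simp only [mul_add, map_add, LinearMap.add_apply, hp, hq]

theorem smul_pderiv_complete (r k : ℕ) :
    ((r : ℝ) + 1) • pderiv r (complete k) =
      if r + 1 ≤ k then complete (k - (r + 1)) else 0 := by
  ext m
  have hz := (zee_pos m).ne'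
  have hr : (r : ℝ) + 1 ≠ 0 := by positivity
  have hm : (m r : ℝ) + 1 ≠ 0 := by positivity
  rw [coeff_smul, coeff_pderiv, coeff_complete, map_add, wt_single, one_mul, zee_add_single,
    smul_eq_mul, apply_ite (coeff m), coeff_complete, coeff_zero]
  split_ifs <;> first | omega | skip
  · field_simp
  · simp
  · simp

/-- Adjoining a variable `t` to the alphabet replaces `p_k` by `p_k + t^k`. -/
def adjoinVar : SymFun →ₐ[ℝ] Polynomial SymFun :=
  aeval fun k => Polynomial.C (X k) + Polynomial.X ^ (k + 1)

theorem adjoinVar_X (k : ℕ) : adjoinVar (X k) = Polynomial.C (X k) + Polynomial.X ^ (k + 1) := by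
  simp [adjoinVar]

theorem coeff_adjoinVar_mul_X (g : SymFun) (k s : ℕ) :
    (adjoinVar (g * X s)).coeff k = (adjoinVar g).coeff k * X s +
      if s + 1 ≤ k then (adjoinVar g).coeff (k - (s + 1)) else 0 := by
  rw [map_mul, adjoinVar_X, mul_add, Polynomial.coeff_add, Polynomial.coeff_mul_C,
    Polynomial.coeff_mul_X_pow']

theorem constantCoeff_complete (k : ℕ) :
    constantCoeff (complete k) = if k = 0 then (1 : ℝ) else 0 := by
  rw [constantCoeff_eq, coeff_complete, map_zero, zee_zero, inv_one]
  simp only [eq_comm]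

/-- Multiplication by `h_k` is adjoint to extracting the coefficient of `t^k` after adjoining the
variable `t`. -/
theorem pairing_complete_mul (k : ℕ) (f g : SymFun) :
    pairing (complete k * f) g = pairing f ((adjoinVar g).coeff k) := by
  induction g using MvPolynomial.induction_on generalizing k f with
  | C a =>
    have hcoeff : (adjoinVar (C a)).coeff k = C (if k = 0 then a else 0) := by
      rw [algHom_C, Polynomial.algebraMap_apply, Polynomial.coeff_C, algebraMap_eq,
        apply_ite C, map_zero]
    have hpair (f : SymFun) (b : ℝ) : pairing f (C b) = b * constantCoeff f := by
      rw [pairing_comm, ← monomial_zero', pairing_monomial, zee_zero, one_mul, constantCoeff_eq]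
    rw [hcoeff, hpair, hpair, map_mul, constantCoeff_complete]
    split_ifs <;> simp
  | add p q hp hq => simp only [map_add, Polynomial.coeff_add, hp, hq]
  | mul_X g s ih =>
    have leibniz : ((s : ℝ) + 1) • pderiv s (complete k * f) =
        complete k * (((s : ℝ) + 1) • pderiv s f) +
          (if s + 1 ≤ k then complete (k - (s + 1)) else 0) * f := by
      rw [← smul_pderiv_complete, Derivation.leibniz, smul_add, smul_eq_mul, smul_eq_mul,
        mul_smul_comm, smul_mul_assoc, mul_comm f]
    calc pairing (complete k * f) (g * X s)
        = pairing (((s : ℝ) + 1) • pderiv s (complete k * f)) g := by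
          rw [pairing_comm, mul_comm g, pairing_X_mul, pairing_comm]
      _ = pairing (X s * (adjoinVar g).coeff k) f
            + pairing f (if s + 1 ≤ k then (adjoinVar g).coeff (k - (s + 1)) else 0) := by
          rw [leibniz, map_add, LinearMap.add_apply, ih, pairing_X_mul, pairing_comm]
          split_ifs
          · rw [ih]
          · simp
      _ = pairing f ((adjoinVar (g * X s)).coeff k) := by
          rw [coeff_adjoinVar_mul_X, map_add, pairing_comm, mul_comm (X s)]

theorem adjoinVar_complete_succ (n : ℕ) :
    adjoinVar (complete (n + 1)) =
      Polynomial.C (complete (n + 1)) + Polynomial.X * adjoinVar (complete n) := by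
  induction n using Nat.strong_induction_on with
  | _ n ih =>
  have newton_succ (n : ℕ) : ((n : Polynomial SymFun) + 1) * adjoinVar (complete (n + 1)) =
      ∑ r ∈ Finset.range (n + 1), Polynomial.C (X r) * adjoinVar (complete (n - r)) +
        ∑ r ∈ Finset.range (n + 1), Polynomial.X ^ (r + 1) * adjoinVar (complete (n - r)) := by
    simpa only [map_mul, map_add, map_natCast, map_one, map_sum, adjoinVar_X, add_mul,
      Finset.sum_add_distrib] using congrArg adjoinVar (newton n)
  have newton_pred : (n : Polynomial SymFun) * adjoinVar (complete n) =
      ∑ r ∈ Finset.range n, Polynomial.C (X r) * adjoinVar (complete (n - (r + 1))) +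
        ∑ r ∈ Finset.range n, Polynomial.X ^ (r + 1) * adjoinVar (complete (n - (r + 1))) := by
    rcases n with _ | n
    · simp
    · simpa using newton_succ n
  have newton_C : ((n : Polynomial SymFun) + 1) * Polynomial.C (complete (n + 1)) =
      ∑ r ∈ Finset.range (n + 1), Polynomial.C (X r) * Polynomial.C (complete (n - r)) := by
    simpa using congrArg Polynomial.C (newton n)
  have sum_X : ∑ r ∈ Finset.range (n + 1), Polynomial.C (X r) * adjoinVar (complete (n - r)) =
      ∑ r ∈ Finset.range (n + 1), Polynomial.C (X r) * Polynomial.C (complete (n - r)) +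
        Polynomial.X *
          ∑ r ∈ Finset.range n, Polynomial.C (X r) * adjoinVar (complete (n - (r + 1))) := by
    rw [Finset.sum_range_succ, Finset.sum_range_succ, Nat.sub_self, complete_zero, map_one,
      map_one, add_right_comm, Finset.mul_sum, ← Finset.sum_add_distrib]
    congr 1
    refine Finset.sum_congr rfl fun r hr => ?_
    have hr : r < n := Finset.mem_range.1 hr
    have ih := ih (n - (r + 1)) (by omega)
    rw [show n - (r + 1) + 1 = n - r by omega] at ih
    rw [ih, mul_add, mul_left_comm]
  have sum_pow : ∑ r ∈ Finset.range (n + 1),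
        Polynomial.X ^ (r + 1) * adjoinVar (complete (n - r)) =
      Polynomial.X * adjoinVar (complete n) + Polynomial.X *
          ∑ r ∈ Finset.range n, Polynomial.X ^ (r + 1) * adjoinVar (complete (n - (r + 1))) := by
    rw [Finset.sum_range_succ', add_comm, Finset.mul_sum]
    simp only [zero_add, pow_zero, one_mul, Nat.sub_zero, pow_succ', mul_assoc]
  apply mul_left_cancel₀ (show (n : Polynomial SymFun) + 1 ≠ 0 by exact_mod_cast n.succ_ne_zero)
  linear_combination
    newton_succ n + sum_X + sum_pow - newton_C - Polynomial.X * newton_pred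

/-! ### Orthonormality of the Jacobi–Trudi determinants -/

theorem completeInt_natCast (n : ℕ) : completeInt n = complete n := by
  simp [completeInt]

theorem completeInt_of_neg {a : ℤ} (h : a < 0) : completeInt a = 0 := if_pos h

theorem completeInt_zero : completeInt 0 = 1 := by
  rw [← Nat.cast_zero, completeInt_natCast, complete_zero]

theorem adjoinVar_completeInt_succ (a : ℤ) :
    adjoinVar (completeInt (a + 1)) =
      Polynomial.C (completeInt (a + 1)) + Polynomial.X * adjoinVar (completeInt a) := by
  rcases lt_trichotomy a (-1) with h | rfl | h
  · simp [completeInt_of_neg (show a < 0 by omega),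
      completeInt_of_neg (show a + 1 < 0 by omega)]
  · simp [completeInt_of_neg, completeInt_zero]
  · lift a to ℕ using by omega
    exact_mod_cast completeInt_natCast (a + 1) ▸ completeInt_natCast a ▸ adjoinVar_complete_succ a

theorem coeff_adjoinVar_completeInt (a : ℤ) (k : ℕ) :
    (adjoinVar (completeInt a)).coeff k = completeInt (a - k) := by
  have hstep (a : ℤ) : adjoinVar (completeInt a) =
      Polynomial.C (completeInt a) + Polynomial.X * adjoinVar (completeInt (a - 1)) := by
    simpa only [sub_add_cancel] using adjoinVar_completeInt_succ (a - 1)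
  induction k generalizing a with
  | zero => simp [hstep a]
  | succ k ih =>
    rw [hstep, Polynomial.coeff_add, Polynomial.coeff_X_mul, Polynomial.coeff_C_succ, zero_add,
      ih, Nat.cast_add, Nat.cast_one, sub_sub, add_comm (1 : ℤ)]

/-- The Jacobi–Trudi determinant `det [h_{a_i - i + j}]` of a sequence, of which the Schur
functions are the case of decreasing sequences. -/
def jacobiTrudi {m : ℕ} (a : Fin m → ℕ) : SymFun :=
  Matrix.det (Matrix.of fun i j : Fin m => completeInt ((a i : ℤ) - (i : ℤ) + (j : ℤ)))

/-- Subtracting `t` times the preceding column removes `t` from all columns but the first. -/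
theorem adjoinVar_jacobiTrudi {m : ℕ} (a : Fin (m + 1) → ℕ) :
    adjoinVar (jacobiTrudi a) = Matrix.det (Matrix.of fun i j : Fin (m + 1) =>
      Fin.cases (adjoinVar (completeInt ((a i : ℤ) - (i : ℤ))))
        (fun j' : Fin m => Polynomial.C (completeInt ((a i : ℤ) - (i : ℤ) + (j' + 1)))) j) := by
  rw [jacobiTrudi, AlgHom.map_det]
  refine Matrix.det_eq_of_forall_col_eq_smul_add_pred (fun _ => Polynomial.X) (by simp) ?_
  intro i j
  simp only [AlgHom.mapMatrix_apply, Matrix.map_apply, Matrix.of_apply, Fin.cases_succ,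
    Fin.val_succ, Fin.val_castSucc, Nat.cast_add, Nat.cast_one, ← add_assoc]
  exact adjoinVar_completeInt_succ _

theorem coeff_adjoinVar_jacobiTrudi {m : ℕ} (a : Fin (m + 1) → ℕ) (k : ℕ) :
    (adjoinVar (jacobiTrudi a)).coeff k = ∑ i : Fin (m + 1),
      (-1) ^ (i : ℕ) * completeInt ((a i : ℤ) - i - k) *
        Matrix.det (Matrix.of fun i' j : Fin m =>
          completeInt ((a (i.succAbove i') : ℤ) - (i.succAbove i' : ℕ) + (j + 1))) := by
  rw [adjoinVar_jacobiTrudi, Matrix.det_succ_column_zero, Polynomial.finsetSum_coeff]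
  refine Finset.sum_congr rfl fun i _ => ?_
  have hminor (A : Matrix (Fin m) (Fin m) SymFun) :
      Matrix.det (A.map Polynomial.C) = Polynomial.C A.det := by
    rw [RingHom.map_det, RingHom.mapMatrix_apply]
  have hsign : (-1 : Polynomial SymFun) ^ (i : ℕ) = Polynomial.C ((-1) ^ (i : ℕ)) := by simp
  rw [← coeff_adjoinVar_completeInt, hsign, mul_assoc, mul_assoc, Polynomial.coeff_C_mul,
    ← Polynomial.coeff_mul_C, ← hminor]
  rfl

theorem coeff_adjoinVar_jacobiTrudi_of_lt {m : ℕ} {a : Fin (m + 1) → ℕ} (ha : Antitone a) {k : ℕ}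
    (hk : a 0 < k) : (adjoinVar (jacobiTrudi a)).coeff k = 0 := by
  rw [coeff_adjoinVar_jacobiTrudi]
  refine Finset.sum_eq_zero fun i _ => ?_
  have := ha (Fin.zero_le i)
  rw [completeInt_of_neg (by omega), mul_zero, zero_mul]

theorem coeff_adjoinVar_jacobiTrudi_self {m : ℕ} {a : Fin (m + 1) → ℕ} (ha : Antitone a) :
    (adjoinVar (jacobiTrudi a)).coeff (a 0) = jacobiTrudi fun i : Fin m => a i.succ := by
  rw [coeff_adjoinVar_jacobiTrudi, Finset.sum_eq_single_of_mem 0 (Finset.mem_univ 0)]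
  · simp only [Fin.val_zero, pow_zero, one_mul, Nat.cast_zero, sub_zero, sub_self,
      completeInt_zero, Fin.zero_succAbove, jacobiTrudi, Fin.val_succ, Nat.cast_add, Nat.cast_one]
    congr! 4 with i j
    congr 1
    ring
  · intro i _ hi
    have hai := ha (Fin.zero_le i)
    have hpos : 0 < (i : ℕ) := Fin.pos_iff_ne_zero.2 hi
    rw [completeInt_of_neg (by omega), mul_zero, zero_mul]

theorem pairing_jacobiTrudi_prod_complete_self {m : ℕ} {a : Fin m → ℕ} (ha : Antitone a) :
    pairing (jacobiTrudi a) (∏ i, complete (a i)) = 1 := by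
  induction m with
  | zero =>
    rw [Fin.prod_univ_zero, jacobiTrudi, Matrix.det_fin_zero, ← C_1, ← monomial_zero',
      pairing_monomial, zee_zero, monomial_zero', coeff_zero_C, one_mul, one_mul]
  | succ m ih =>
    rw [Fin.prod_univ_succ, pairing_comm, pairing_complete_mul, pairing_comm,
      coeff_adjoinVar_jacobiTrudi_self ha]
    exact ih (ha.comp_monotone Fin.strictMono_succ.monotone)

theorem toLex_lt_toLex {m : ℕ} {a b : Fin m → ℕ} :
    toLex a < toLex b ↔ ∃ i, (∀ j < i, a j = b j) ∧ a i < b i := Iff.rfl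

theorem pairing_jacobiTrudi_prod_complete_of_lt {m : ℕ} {a b : Fin m → ℕ} (ha : Antitone a)
    (h : toLex a < toLex b) : pairing (jacobiTrudi a) (∏ i, complete (b i)) = 0 := by
  obtain ⟨i, heq, hlt⟩ := toLex_lt_toLex.1 h
  induction m with
  | zero => exact i.elim0
  | succ m ih =>
    rw [Fin.prod_univ_succ, pairing_comm, pairing_complete_mul, pairing_comm]
    rcases Fin.eq_zero_or_eq_succ i with rfl | ⟨i, rfl⟩
    · rw [coeff_adjoinVar_jacobiTrudi_of_lt ha hlt, map_zero, LinearMap.zero_apply]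
    · rw [← heq 0 (Fin.succ_pos i), coeff_adjoinVar_jacobiTrudi_self ha]
      have heq_succ : ∀ j < i, a j.succ = b j.succ := fun j hj =>
        heq _ (Fin.succ_lt_succ_iff.2 hj)
      exact ih (ha.comp_monotone Fin.strictMono_succ.monotone)
        (toLex_lt_toLex.2 ⟨i, heq_succ, hlt⟩) i heq_succ hlt

theorem exists_lt_apply_of_ne_one {m : ℕ} {w : Equiv.Perm (Fin m)} (hw : w ≠ 1) :
    ∃ i, (∀ j < i, w j = j) ∧ i < w i := by
  obtain ⟨i, hi, hmin⟩ := WellFounded.has_min wellFounded_lt {i | w i ≠ i} (by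
    by_contra! hne
    exact hw (Equiv.ext fun i => not_not.1 (Set.eq_empty_iff_forall_notMem.1 hne i)))
  have hfix : ∀ j < i, w j = j := fun j hj => not_not.1 fun hne => hmin j hne hj
  refine ⟨i, hfix, lt_of_le_of_ne ?_ (Ne.symm hi)⟩
  by_contra! hlt
  exact hi (w.injective (hfix _ hlt))

theorem prod_completeInt_eq_zero_or {m : ℕ} (a : Fin m → ℕ) {w : Equiv.Perm (Fin m)}
    (hw : w ≠ 1) :
    ∏ i, completeInt ((a i : ℤ) - (i : ℤ) + (w i : ℤ)) = 0 ∨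
    ∃ b : Fin m → ℕ, ∏ i, completeInt ((a i : ℤ) - (i : ℤ) + (w i : ℤ)) = ∏ i, complete (b i) ∧
      ∑ i, b i = ∑ i, a i ∧ toLex a < toLex b := by
  by_cases! hneg : ∃ i, (a i : ℤ) - (i : ℤ) + (w i : ℤ) < 0
  · obtain ⟨i, hi⟩ := hneg
    exact .inl (Finset.prod_eq_zero (Finset.mem_univ i) (completeInt_of_neg hi))
  choose b hb using fun i => Int.eq_ofNat_of_zero_le (hneg i)
  refine .inr ⟨b, by simp only [hb, completeInt_natCast], ?_, ?_⟩
  · have hsum := Equiv.sum_comp w fun i => (i : ℤ)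
    zify
    simp only [← hb, Finset.sum_add_distrib, Finset.sum_sub_distrib]
    rw [hsum, sub_add_cancel]
  · obtain ⟨i, hfix, hmoved⟩ := exists_lt_apply_of_ne_one hw
    refine toLex_lt_toLex.2 ⟨i, fun j hj => ?_, ?_⟩
    · have hbj := hb j
      rw [hfix j hj] at hbj
      omega
    · have hbi := hb i
      rw [Fin.lt_def] at hmoved
      omega

theorem jacobiTrudi_eq_sum {m : ℕ} (a : Fin m → ℕ) : jacobiTrudi a =
    ∑ w : Equiv.Perm (Fin m), ((Equiv.Perm.sign w : ℤ) : ℝ) •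
      ∏ i, completeInt ((a i : ℤ) - (i : ℤ) + (w i : ℤ)) := by
  rw [jacobiTrudi, ← Matrix.det_transpose, Matrix.det_apply]
  refine Finset.sum_congr rfl fun w _ => ?_
  rw [Units.smul_def, ← Int.cast_smul_eq_zsmul ℝ]
  rfl

/-- A functional on the space of symmetric functions sees only the diagonal term of a
Jacobi–Trudi determinant when it kills all lexicographically larger products of complete symmetric
functions. -/
theorem apply_jacobiTrudi {m : ℕ} (a : Fin m → ℕ) (φ : SymFun →ₗ[ℝ] ℝ)
    (hφ : ∀ b : Fin m → ℕ, ∑ i, b i = ∑ i, a i → toLex a < toLex b →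
      φ (∏ i, complete (b i)) = 0) :
    φ (jacobiTrudi a) = φ (∏ i, complete (a i)) := by
  rw [jacobiTrudi_eq_sum, map_sum, Finset.sum_eq_single_of_mem 1 (Finset.mem_univ 1)]
  · simp [completeInt_natCast]
  · intro w _ hw
    rw [map_smul]
    rcases prod_completeInt_eq_zero_or a hw with h | ⟨b, hprod, hsum, hlt⟩
    · rw [h, map_zero, smul_zero]
    · rw [hprod, hφ b hsum hlt, smul_zero]

theorem pairing_jacobiTrudi_self {m : ℕ} {a : Fin m → ℕ} (ha : Antitone a) :
    pairing (jacobiTrudi a) (jacobiTrudi a) = 1 := by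
  rw [apply_jacobiTrudi a (pairing (jacobiTrudi a)) fun _ _ hb =>
    pairing_jacobiTrudi_prod_complete_of_lt ha hb, pairing_jacobiTrudi_prod_complete_self ha]

theorem pairing_jacobiTrudi_of_lt {m : ℕ} {a b : Fin m → ℕ} (ha : Antitone a)
    (h : toLex a < toLex b) : pairing (jacobiTrudi a) (jacobiTrudi b) = 0 := by
  rw [apply_jacobiTrudi b (pairing (jacobiTrudi a)) fun _ _ hc =>
    pairing_jacobiTrudi_prod_complete_of_lt ha (h.trans hc),
    pairing_jacobiTrudi_prod_complete_of_lt ha h]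

theorem pairing_jacobiTrudi_of_ne {m : ℕ} {a b : Fin m → ℕ} (ha : Antitone a) (hb : Antitone b)
    (h : a ≠ b) : pairing (jacobiTrudi a) (jacobiTrudi b) = 0 := by
  rcases lt_or_gt_of_ne (toLex.injective.ne h) with hlt | hlt
  · exact pairing_jacobiTrudi_of_lt ha hlt
  · rw [pairing_comm, pairing_jacobiTrudi_of_lt hb hlt]

theorem jacobiTrudi_snoc_zero {m : ℕ} (a : Fin (m + 1) → ℕ) (h : a (Fin.last m) = 0) :
    jacobiTrudi a = jacobiTrudi fun i : Fin m => a i.castSucc := by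
  rw [jacobiTrudi, Matrix.det_succ_row _ (Fin.last m),
    Finset.sum_eq_single_of_mem (Fin.last m) (Finset.mem_univ _)]
  · rw [Matrix.of_apply, h, Even.neg_one_pow ⟨_, rfl⟩]
    simp only [Nat.cast_zero, Fin.val_last, zero_sub, neg_add_cancel, completeInt_zero, one_mul,
      Fin.succAbove_last, jacobiTrudi]
    rfl
  · intro j _ hj
    have : (j : ℕ) < m := Fin.val_lt_last hj
    rw [Matrix.of_apply, h, completeInt_of_neg (by simpa using this), mul_zero, zero_mul]

end SymFun

/-! ### Rows of a diagram -/

namespace YoungGraph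

variable {lam mu : YoungDiagram}

theorem colLen_zero_le_card (lam : YoungDiagram) : lam.colLen 0 ≤ lam.card := by
  rw [YoungDiagram.colLen_eq_card]
  exact Finset.card_le_card (Finset.filter_subset _ _)

theorem fst_lt_card {c : ℕ × ℕ} (hc : c ∈ lam) : c.1 < lam.card :=
  (YoungDiagram.mem_iff_lt_colLen.1 (lam.up_left_mem le_rfl (Nat.zero_le _) hc)).trans_le
    (colLen_zero_le_card lam)

theorem rowLen_eq_zero {i : ℕ} (h : lam.colLen 0 ≤ i) : lam.rowLen i = 0 := by
  by_contra hne
  have hmem : (i, 0) ∈ lam := YoungDiagram.mem_iff_lt_rowLen.2 (Nat.pos_of_ne_zero hne)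
  exact h.not_gt (YoungDiagram.mem_iff_lt_colLen.1 hmem)

theorem sum_range_rowLen {n : ℕ} (hn : lam.colLen 0 ≤ n) :
    ∑ i ∈ Finset.range n, lam.rowLen i = lam.card := by
  rw [YoungDiagram.card, Finset.card_eq_sum_card_fiberwise (f := Prod.fst) (t := Finset.range n)]
  · exact Finset.sum_congr rfl fun i _ => lam.rowLen_eq_card
  · intro c hc
    have hrow : (c.1, 0) ∈ lam := lam.up_left_mem le_rfl (Nat.zero_le _) hc
    exact Finset.mem_coe.2 (Finset.mem_range.2
      ((YoungDiagram.mem_iff_lt_colLen.1 hrow).trans_le hn))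

theorem sum_rowLen (lam : YoungDiagram) : ∑ i : Fin lam.card, lam.rowLen i = lam.card := by
  rw [Fin.sum_univ_eq_sum_range fun i => lam.rowLen i, sum_range_rowLen (colLen_zero_le_card lam)]

theorem sum_rowLens (lam : YoungDiagram) : lam.rowLens.sum = lam.card := by
  rw [← sum_range_rowLen le_rfl]
  rfl

theorem rowLen_antitone (lam : YoungDiagram) (N : ℕ) : Antitone fun i : Fin N => lam.rowLen i :=
  fun i j h => lam.rowLen_anti i j h

theorem rowLen_ne_of_ne {N : ℕ} (hlam : lam.card = N) (hmu : mu.card = N) (h : lam ≠ mu) :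
    (fun i : Fin N => lam.rowLen i) ≠ fun i : Fin N => mu.rowLen i := by
  refine fun heq => h (YoungDiagram.ext (Finset.ext fun ⟨i, j⟩ => ?_))
  have hrow : lam.rowLen i = mu.rowLen i := by
    by_cases hi : i < N
    · exact congrFun heq ⟨i, hi⟩
    · rw [rowLen_eq_zero ((colLen_zero_le_card lam).trans (by omega)),
        rowLen_eq_zero ((colLen_zero_le_card mu).trans (by omega))]
  rw [YoungDiagram.mem_cells, YoungDiagram.mem_cells, YoungDiagram.mem_iff_lt_rowLen,
    YoungDiagram.mem_iff_lt_rowLen, hrow]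

theorem diagLen_eq_card_filter (lam : YoungDiagram) :
    diagLen lam = (Finset.univ.filter fun i : Fin lam.card => (i : ℕ) < lam.rowLen i).card := by
  rw [diagLen, ← Finset.card_map ⟨fun i : Fin lam.card => ((i : ℕ), (i : ℕ)), fun i j h =>
    Fin.ext (congrArg Prod.fst h)⟩]
  congr 1
  ext ⟨i, j⟩
  simp only [Finset.mem_filter, YoungDiagram.mem_cells, Finset.mem_map, Finset.mem_univ, true_and]
  constructor
  · rintro ⟨hmem, rfl⟩
    exact ⟨⟨i, fst_lt_card hmem⟩, YoungDiagram.mem_iff_lt_rowLen.1 hmem, rfl⟩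
  · rintro ⟨k, hk, ⟨⟩⟩
    exact ⟨YoungDiagram.mem_iff_lt_rowLen.2 hk, rfl⟩

end YoungGraph

namespace SymFun

open MvPolynomial

/-! ### Exponents of power sum products -/

/-- The exponent of the monomial `∏ p_r` over the elements `r` of a multiset of positive numbers;
the shift accounts for `p_r = X (r - 1)`. -/
def powerExp : Multiset ℕ →+ ℕ →₀ ℕ :=
  Multiset.toFinsupp.toAddMonoidHom.comp (Multiset.mapAddMonoidHom Nat.pred)

theorem powerExp_cons (r : ℕ) (s : Multiset ℕ) :
    powerExp (r ::ₘ s) = Finsupp.single (r - 1) 1 + powerExp s := by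
  rw [← Multiset.singleton_add, map_add]
  exact congrArg (· + _) (Multiset.toFinsupp_singleton _)

theorem powerExp_map_succ (s : Multiset ℕ) : powerExp (s.map Nat.succ) = Multiset.toFinsupp s :=
  congrArg Multiset.toFinsupp ((Multiset.map_map _ _ _).trans (Multiset.map_id s))

theorem wt_powerExp {s : Multiset ℕ} (hs : ∀ r ∈ s, 0 < r) : wt (powerExp s) = s.sum := by
  induction s using Multiset.induction_on with
  | empty => simp
  | cons r s ih =>
    rw [Multiset.forall_mem_cons] at hs
    rw [powerExp_cons, map_add, wt_single, ih hs.2, Multiset.sum_cons, one_mul,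
      Nat.sub_add_cancel hs.1]

theorem degree_powerExp (s : Multiset ℕ) : (powerExp s).degree = s.card := by
  induction s using Multiset.induction_on with
  | empty => simp
  | cons r s ih => rw [powerExp_cons, map_add, Finsupp.degree_single, ih, Multiset.card_cons,
      add_comm]

theorem monomial_powerExp (s : Multiset ℕ) :
    monomial (powerExp s) (1 : ℝ) = (s.map fun r => X (r - 1)).prod := by
  induction s using Multiset.induction_on with
  | empty => simp
  | cons r s ih =>
    rw [powerExp_cons, ← one_mul (1 : ℝ), ← monomial_mul, ih, Multiset.map_cons,
      Multiset.prod_cons]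
    rfl

theorem map_succ_map_pred {s : Multiset ℕ} (hs : ∀ r ∈ s, 0 < r) :
    (s.map Nat.pred).map Nat.succ = s := by
  rw [Multiset.map_map]
  exact (Multiset.map_congr rfl fun r hr => Nat.succ_pred_eq_of_pos (hs r hr)).trans
    (Multiset.map_id s)

theorem powerExp_injOn : Set.InjOn powerExp {s | ∀ r ∈ s, 0 < r} := by
  intro s hs t ht h
  have hmap : s.map Nat.pred = t.map Nat.pred := Multiset.toFinsupp.injective h
  rw [← map_succ_map_pred hs, hmap, map_succ_map_pred ht]

theorem zee_powerExp {s : Multiset ℕ} (hs : ∀ r ∈ s, 0 < r) :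
    zee (powerExp s) = (s.prod * ∏ r ∈ s.toFinset, (s.count r).factorial : ℕ) := by
  obtain ⟨s, rfl⟩ : ∃ t : Multiset ℕ, t.map Nat.succ = s := ⟨_, map_succ_map_pred hs⟩
  rw [Finset.prod_multiset_count, ← Finset.prod_mul_distrib, Multiset.toFinset_map,
    Finset.prod_image Nat.succ_injective.injOn, powerExp_map_succ, zee, Finsupp.prod,
    Multiset.toFinsupp_support]
  push_cast
  simp only [Multiset.count_map_eq_count' _ _ Nat.succ_injective, Multiset.toFinsupp_apply]

theorem exists_powerExp_eq (m : ℕ →₀ ℕ) : ∃ s, (∀ r ∈ s, 0 < r) ∧ powerExp s = m := by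
  refine ⟨(Finsupp.toMultiset m).map Nat.succ, fun r hr => ?_, ?_⟩
  · obtain ⟨k, -, rfl⟩ := Multiset.mem_map.1 hr
    exact k.succ_pos
  · rw [powerExp_map_succ, Finsupp.toMultiset_toFinsupp]

/-- The exponent of the monomial `∏ p_{lam_i}` indexed by a diagram. -/
def rowExp (lam : YoungDiagram) : ℕ →₀ ℕ := powerExp lam.rowLens

theorem wt_rowExp (lam : YoungDiagram) : wt (rowExp lam) = lam.card := by
  rw [rowExp, wt_powerExp fun r hr => lam.pos_of_mem_rowLens r hr, Multiset.sum_coe,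
    YoungGraph.sum_rowLens]

theorem rowExp_injective : Function.Injective rowExp := by
  intro lam mu h
  have hrows : (lam.rowLens : Multiset ℕ) = mu.rowLens :=
    powerExp_injOn (fun r hr => lam.pos_of_mem_rowLens r hr)
      (fun r hr => mu.pos_of_mem_rowLens r hr) h
  exact YoungDiagram.equivListRowLens.injective (Subtype.ext
    ((Multiset.coe_eq_coe.1 hrows).eq_of_sortedGE lam.rowLens_sorted mu.rowLens_sorted))

theorem exists_rowExp_eq (m : ℕ →₀ ℕ) : ∃ lam, rowExp lam = m := by
  obtain ⟨s, hpos, rfl⟩ := exists_powerExp_eq m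
  refine ⟨YoungDiagram.ofRowLens (s.sort (· ≥ ·)) (Multiset.pairwise_sort _ _).sortedGE, ?_⟩
  rw [rowExp, YoungDiagram.rowLens_ofRowLens_eq_self
    fun r hr => hpos r ((Multiset.mem_sort _).1 hr), Multiset.sort_eq]

/-! ### The Schur functions form an orthonormal basis -/

theorem schur_eq_jacobiTrudi_of_colLen_le (lam : YoungDiagram) {m : ℕ} (hm : lam.colLen 0 ≤ m) :
    schur lam = jacobiTrudi fun i : Fin m => lam.rowLen i := by
  induction m, hm using Nat.le_induction with
  | base => rfl
  | succ m hm ih =>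
    rw [jacobiTrudi_snoc_zero _ (YoungGraph.rowLen_eq_zero hm), ih]
    rfl

theorem schur_eq_jacobiTrudi {lam : YoungDiagram} {N : ℕ} (h : lam.card = N) :
    schur lam = jacobiTrudi fun i : Fin N => lam.rowLen i :=
  schur_eq_jacobiTrudi_of_colLen_le lam (h ▸ YoungGraph.colLen_zero_le_card lam)

theorem pairing_schur_self (lam : YoungDiagram) : pairing (schur lam) (schur lam) = 1 := by
  rw [schur_eq_jacobiTrudi rfl, pairing_jacobiTrudi_self (YoungGraph.rowLen_antitone lam _)]

theorem pairing_schur_of_ne {lam mu : YoungDiagram} (hcard : lam.card = mu.card) (h : lam ≠ mu) :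
    pairing (schur lam) (schur mu) = 0 := by
  rw [schur_eq_jacobiTrudi hcard, schur_eq_jacobiTrudi rfl]
  exact pairing_jacobiTrudi_of_ne (YoungGraph.rowLen_antitone _ _)
    (YoungGraph.rowLen_antitone _ _) (YoungGraph.rowLen_ne_of_ne hcard rfl h)

theorem isWeightedHomogeneous_complete (n : ℕ) :
    IsWeightedHomogeneous (fun k : ℕ => k + 1) (complete n) n := by
  intro m hm
  rw [coeff_complete] at hm
  by_contra h
  exact hm (if_neg h)

theorem isWeightedHomogeneous_jacobiTrudi {m : ℕ} (a : Fin m → ℕ) :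
    IsWeightedHomogeneous (fun k : ℕ => k + 1) (jacobiTrudi a) (∑ i, a i) := by
  have hprod (b : Fin m → ℕ) :
      IsWeightedHomogeneous (fun k : ℕ => k + 1) (∏ i, complete (b i)) (∑ i, b i) :=
    IsWeightedHomogeneous.prod _ _ _ fun i _ => isWeightedHomogeneous_complete (b i)
  rw [jacobiTrudi_eq_sum]
  refine IsWeightedHomogeneous.sum _ _ _ fun w _ =>
    (weightedHomogeneousSubmodule ℝ _ _).smul_mem _ ?_
  by_cases hw : w = 1
  · simpa [hw, completeInt_natCast] using hprod a
  rcases prod_completeInt_eq_zero_or a hw with h | ⟨b, h, hsum, -⟩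
  · rw [h]
    exact Submodule.zero_mem _
  · rw [h, ← hsum]
    exact hprod b

theorem isWeightedHomogeneous_schur (lam : YoungDiagram) :
    IsWeightedHomogeneous (fun k : ℕ => k + 1) (schur lam) lam.card := by
  have h := isWeightedHomogeneous_jacobiTrudi fun i : Fin lam.card => lam.rowLen i
  rwa [YoungGraph.sum_rowLen, ← schur_eq_jacobiTrudi rfl] at h

theorem pairing_eq_sum_level {f : SymFun} {N : ℕ}
    (hf : IsWeightedHomogeneous (fun k : ℕ => k + 1) f N) (g : SymFun) :
    pairing f g = ∑ mu ∈ YoungGraph.level N,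
      zee (rowExp mu) * coeff (rowExp mu) f * coeff (rowExp mu) g := by
  classical
  have hsupp : f.support ⊆ (YoungGraph.level N).image rowExp := by
    intro m hm
    obtain ⟨mu, rfl⟩ := exists_rowExp_eq m
    refine Finset.mem_image_of_mem _ (YoungGraph.mem_level.2 ?_)
    rw [← wt_rowExp, hf (mem_support_iff.1 hm)]
  rw [pairing_eq_sum, Finset.sum_subset hsupp fun m _ hm => by simp [notMem_support_iff.1 hm],
    Finset.sum_image rowExp_injective.injOn]

/-- The orthonormality of the Schur functions of degree `N` says that a square matrix has a right
inverse; that this is also a left inverse is their completeness. -/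
theorem eq_sum_pairing_schur {f : SymFun} {N : ℕ}
    (hf : IsWeightedHomogeneous (fun k : ℕ => k + 1) f N) :
    f = ∑ lam ∈ YoungGraph.level N, pairing (schur lam) f • schur lam := by
  classical
  let A : Matrix (YoungGraph.level N) (YoungGraph.level N) ℝ :=
    Matrix.of fun lam mu => zee (rowExp mu) * coeff (rowExp mu.1) (schur lam)
  let B : Matrix (YoungGraph.level N) (YoungGraph.level N) ℝ :=
    Matrix.of fun mu lam => coeff (rowExp mu.1) (schur lam)
  have hcard (lam : YoungGraph.level N) : lam.1.card = N := YoungGraph.mem_level.1 lam.2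
  have hA (lam : YoungGraph.level N) (g : SymFun) :
      pairing (schur lam) g = ∑ mu, A lam mu * coeff (rowExp mu.1) g := by
    rw [pairing_eq_sum_level (hcard lam ▸ isWeightedHomogeneous_schur lam.1),
      ← Finset.sum_coe_sort]
    rfl
  have hAB : A * B = 1 := by
    ext lam mu
    rw [Matrix.mul_apply, Matrix.one_apply]
    refine (hA lam (schur mu)).symm.trans ?_
    split_ifs with h
    · rw [h, pairing_schur_self]
    · rw [pairing_schur_of_ne ((hcard lam).trans (hcard mu).symm) (Subtype.coe_ne_coe.2 h)]
  have hBA : B * A = 1 := mul_eq_one_comm.1 hAB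
  have hsum : IsWeightedHomogeneous (fun k : ℕ => k + 1)
      (∑ lam ∈ YoungGraph.level N, pairing (schur lam) f • schur lam) N :=
    IsWeightedHomogeneous.sum _ _ _ fun lam hlam =>
      (weightedHomogeneousSubmodule ℝ _ _).smul_mem _
        (YoungGraph.mem_level.1 hlam ▸ isWeightedHomogeneous_schur lam)
  ext m
  by_cases hm : wt m = N
  · obtain ⟨mu, rfl⟩ := exists_rowExp_eq m
    have hmu : mu ∈ YoungGraph.level N := YoungGraph.mem_level.2 (wt_rowExp mu ▸ hm)
    let c : YoungGraph.level N → ℝ := fun nu => coeff (rowExp nu.1) f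
    calc coeff (rowExp mu) f = ((B * A).mulVec c) ⟨mu, hmu⟩ := by rw [hBA, Matrix.one_mulVec]
      _ = ∑ lam, B ⟨mu, hmu⟩ lam * pairing (schur lam) f := by
        rw [← Matrix.mulVec_mulVec]
        simp only [hA, Matrix.mulVec, dotProduct, c]
      _ = _ := by
        rw [coeff_sum, ← Finset.sum_coe_sort (YoungGraph.level N)]
        simp only [coeff_smul, smul_eq_mul, mul_comm, B, Matrix.of_apply]
  · rw [hf.coeff_eq_zero m hm, hsum.coeff_eq_zero m hm]

theorem constantCoeff_completeInt_of_pos {a : ℤ} (ha : 0 < a) :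
    constantCoeff (completeInt a) = (0 : ℝ) := by
  lift a to ℕ using ha.le
  rw [completeInt_natCast, constantCoeff_complete, if_neg (by omega)]

theorem completeInt_mem_idealOfVars {a : ℤ} (ha : 0 < a) :
    completeInt a ∈ idealOfVars ℕ ℝ := by
  rw [← pow_one (idealOfVars ℕ ℝ), mem_pow_idealOfVars_iff']
  intro m hm
  rw [(Finsupp.degree_eq_zero_iff m).1 (Nat.lt_one_iff.1 hm), ← constantCoeff_eq,
    constantCoeff_completeInt_of_pos ha]

/-- The entries of the Jacobi–Trudi matrix in row `i` have positive degree as soon as `i < a i`. -/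
theorem jacobiTrudi_mem_pow_idealOfVars {m : ℕ} (a : Fin m → ℕ) :
    jacobiTrudi a ∈ idealOfVars ℕ ℝ ^ (Finset.univ.filter fun i : Fin m => (i : ℕ) < a i).card := by
  rw [jacobiTrudi_eq_sum]
  refine Ideal.sum_mem _ fun w _ => Submodule.smul_of_tower_mem _ _ ?_
  rw [← Finset.prod_filter_mul_prod_filter_not Finset.univ fun i : Fin m => (i : ℕ) < a i,
    ← Finset.prod_const]
  refine Ideal.mul_mem_right _ _ (Ideal.prod_mem_prod fun i hi => completeInt_mem_idealOfVars ?_)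
  have := (Finset.mem_filter.1 hi).2
  omega

theorem pairing_schur_monomial_of_degree_lt {lam : YoungDiagram} {m : ℕ →₀ ℕ}
    (h : m.degree < YoungGraph.diagLen lam) : pairing (schur lam) (monomial m 1) = 0 := by
  have hmem := jacobiTrudi_mem_pow_idealOfVars fun i : Fin lam.card => lam.rowLen i
  rw [← YoungGraph.diagLen_eq_card_filter, ← schur_eq_jacobiTrudi rfl,
    mem_pow_idealOfVars_iff'] at hmem
  rw [pairing_comm, pairing_monomial, hmem m h, mul_zero, mul_zero]

end SymFun

namespace SymmetricGroup

open Equiv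

/-! ### The characteristic map -/

section CycleType

variable {X : Type*} [Fintype X] [DecidableEq X]

theorem exists_partition_parts_eq {s : Multiset ℕ} (hpos : ∀ r ∈ s, 0 < r)
    (hsum : s.sum = Fintype.card X) : ∃ g : Perm X, g.partition.parts = s := by
  have hsplit := Multiset.filter_add_not (2 ≤ ·) s
  have hones : s.filter (¬ 2 ≤ ·) = Multiset.replicate (s.filter (¬ 2 ≤ ·)).card 1 :=
    Multiset.eq_replicate_of_mem fun r hr => by
      obtain ⟨hmem, hr⟩ := Multiset.mem_filter.1 hr
      have := hpos r hmem
      omega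
  have hcard := congrArg Multiset.sum hsplit
  rw [Multiset.sum_add, hones, Multiset.sum_replicate, smul_eq_mul, mul_one, hsum] at hcard
  obtain ⟨g, hg⟩ := (Perm.exists_with_cycleType_iff X (m := s.filter (2 ≤ ·))).2
    ⟨by omega, fun r hr => (Multiset.mem_filter.1 hr).2⟩
  refine ⟨g, ?_⟩
  rw [Perm.parts_partition, ← Perm.sum_cycleType, hg, ← hcard, Nat.add_sub_cancel_left, ← hones,
    hsplit]

/-- The exponent of the power sum monomial of the cycle lengths of a permutation. -/
def cycleExp (g : Perm X) : ℕ →₀ ℕ := SymFun.powerExp g.partition.parts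

theorem wt_cycleExp (g : Perm X) : SymFun.wt (cycleExp g) = Fintype.card X :=
  (SymFun.wt_powerExp fun _ => g.partition.parts_pos).trans g.partition.parts_sum

theorem cycleExp_eq_iff_isConj {g h : Perm X} : cycleExp g = cycleExp h ↔ IsConj g h := by
  rw [Perm.partition_eq_of_isConj, Nat.Partition.ext_iff]
  exact SymFun.powerExp_injOn.eq_iff (fun _ => g.partition.parts_pos)
    fun _ => h.partition.parts_pos

theorem exists_cycleExp_eq {m : ℕ →₀ ℕ} (hm : SymFun.wt m = Fintype.card X) :
    ∃ g : Perm X, cycleExp g = m := by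
  obtain ⟨s, hpos, rfl⟩ := SymFun.exists_powerExp_eq m
  obtain ⟨g, rfl⟩ := exists_partition_parts_eq hpos ((SymFun.wt_powerExp hpos).symm.trans hm)
  exact ⟨g, rfl⟩

theorem zee_cycleExp (g : Perm X) :
    SymFun.zee (cycleExp g) = ((Fintype.card X - g.cycleType.sum).factorial * g.cycleType.prod *
      ∏ r ∈ g.cycleType.toFinset, (g.cycleType.count r).factorial : ℕ) := by
  have hone : (1 : ℕ) ∉ g.cycleType := fun h => lt_irrefl _ (Perm.one_lt_of_mem_cycleType h)
  have hsub : g.partition.parts.toFinset ⊆ insert 1 g.cycleType.toFinset := by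
    intro r hr
    rw [Multiset.mem_toFinset, Perm.parts_partition, Multiset.mem_add] at hr
    rw [Finset.mem_insert, Multiset.mem_toFinset]
    exact hr.symm.imp_left Multiset.eq_of_mem_replicate
  rw [cycleExp, SymFun.zee_powerExp fun _ => g.partition.parts_pos,
    Finset.prod_subset hsub fun r _ hr => by
      rw [Multiset.count_eq_zero_of_notMem (mt Multiset.mem_toFinset.2 hr), Nat.factorial_zero],
    Finset.prod_insert (mt Multiset.mem_toFinset.1 hone), Perm.parts_partition,
    ← Perm.sum_cycleType, Multiset.prod_add, Multiset.prod_replicate, one_pow, mul_one,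
    Multiset.count_add, Multiset.count_eq_zero_of_notMem hone, zero_add,
    Multiset.count_replicate_self, ← mul_assoc, mul_comm g.cycleType.prod]
  congr 2
  refine Finset.prod_congr rfl fun r hr => ?_
  rw [Multiset.count_add, Multiset.count_replicate, if_neg, add_zero]
  rintro rfl
  exact hone (Multiset.mem_toFinset.1 hr)

theorem card_filter_cycleExp_eq_mul_zee {m : ℕ →₀ ℕ} (hm : SymFun.wt m = Fintype.card X) :
    ((Finset.univ.filter fun g : Perm X => cycleExp g = m).card : ℝ) * SymFun.zee m =
      (Fintype.card X).factorial := by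
  obtain ⟨g, rfl⟩ := exists_cycleExp_eq hm
  have hclass : Nat.card {h | IsConj g h} =
      (Finset.univ.filter fun h : Perm X => cycleExp h = cycleExp g).card := by
    rw [Nat.card_eq_card_toFinset]
    congr 1
    ext h
    rw [Set.mem_toFinset, Finset.mem_filter, eq_comm, cycleExp_eq_iff_isConj]
    exact (and_iff_right (Finset.mem_univ _)).symm
  rw [zee_cycleExp, ← hclass, ← Nat.cast_mul, Perm.card_isConj_mul_eq]

end CycleType

section CharMap

open MvPolynomial

variable {X : Type*} [Fintype X] [DecidableEq X]

/-- The power sum product `∏ p_r` over the cycle lengths `r` of a permutation. -/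
def cycleMonomial (g : Perm X) : SymFun := monomial (cycleExp g) 1

theorem sum_cycleMonomial : ∑ g : Perm X, cycleMonomial g =
    ((Fintype.card X).factorial : ℝ) • SymFun.complete (Fintype.card X) := by
  ext m
  rw [coeff_sum, coeff_smul, SymFun.coeff_complete]
  simp only [cycleMonomial, coeff_monomial]
  rw [← Finset.sum_filter, Finset.sum_const, nsmul_eq_mul, mul_one]
  split_ifs with h
  · rw [← card_filter_cycleExp_eq_mul_zee h, smul_eq_mul, mul_assoc,
      mul_inv_cancel₀ (SymFun.zee_pos m).ne', mul_one]
  · rw [smul_zero, Nat.cast_eq_zero, Finset.card_eq_zero, Finset.filter_eq_empty_iff]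
    rintro g - rfl
    exact h (wt_cycleExp g)

/-- Frobenius' characteristic map `χ ↦ |S_X|⁻¹ ∑ χ(g) p_{type g}` from functions on a symmetric
group to symmetric functions. -/
def charMap (χ : Perm X → ℝ) : SymFun :=
  ((Fintype.card X).factorial : ℝ)⁻¹ • ∑ g, χ g • cycleMonomial g

theorem pairing_charMap (χ : Perm X → ℝ) (f : SymFun) : SymFun.pairing (charMap χ) f =
    ((Fintype.card X).factorial : ℝ)⁻¹ * ∑ g, χ g * SymFun.pairing (cycleMonomial g) f := by
  simp only [charMap, map_smul, LinearMap.smul_apply, map_sum, LinearMap.sum_apply, smul_eq_mul]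

variable {χ : Perm X → ℝ} (hχ : ∀ g h, IsConj g h → χ g = χ h)
include hχ

theorem pairing_charMap_cycleMonomial (g : Perm X) :
    SymFun.pairing (charMap χ) (cycleMonomial g) = χ g := by
  have hterm (h : Perm X) : χ h * SymFun.pairing (cycleMonomial h) (cycleMonomial g) =
      if cycleExp h = cycleExp g then χ g * SymFun.zee (cycleExp g) else 0 := by
    rw [cycleMonomial, cycleMonomial, SymFun.pairing_monomial, coeff_monomial]
    by_cases heq : cycleExp h = cycleExp g
    · rw [if_pos heq, if_pos heq.symm, hχ h g (cycleExp_eq_iff_isConj.1 heq), heq]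
      ring
    · rw [if_neg heq, if_neg (Ne.symm heq)]
      ring
  rw [pairing_charMap, Finset.sum_congr rfl fun h _ => hterm h, ← Finset.sum_filter,
    Finset.sum_const, nsmul_eq_mul, mul_left_comm (_ : ℝ) (χ g),
    card_filter_cycleExp_eq_mul_zee (wt_cycleExp g), mul_left_comm,
    inv_mul_cancel₀ (by positivity), mul_one]

theorem pairing_charMap_self : SymFun.pairing (charMap χ) (charMap χ) =
    ((Fintype.card X).factorial : ℝ)⁻¹ * ∑ g, χ g * χ g := by
  rw [pairing_charMap]
  congr 1
  refine Finset.sum_congr rfl fun g _ => ?_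
  rw [SymFun.pairing_comm, pairing_charMap_cycleMonomial hχ]

end CharMap

section Fibers

variable {X ι : Type*} [DecidableEq ι] (f : X → ι)

theorem disjoint_ofSubtype_fiber (F : ∀ i, Perm {x // f x = i}) {i j : ι} (h : i ≠ j) :
    (Perm.ofSubtype (F i)).Disjoint (Perm.ofSubtype (F j)) := by
  intro x
  by_cases hx : f x = i
  · exact .inr (Perm.ofSubtype_apply_of_not_mem _ fun hj => h (hx.symm.trans hj))
  · exact .inl (Perm.ofSubtype_apply_of_not_mem _ hx)

theorem pairwise_commute_ofSubtype_fiber (F : ∀ i, Perm {x // f x = i}) (s : Set ι) :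
    s.Pairwise (Function.onFun Commute fun i => Perm.ofSubtype (F i)) :=
  fun _ _ _ _ h => (disjoint_ofSubtype_fiber f F h).commute

/-- The permutation which preserves the fibers of `f` and acts on them in the given way. -/
def ofFibers [Fintype ι] (F : ∀ i, Perm {x // f x = i}) : Perm X :=
  Finset.univ.noncommProd (fun i => Perm.ofSubtype (F i))
    (pairwise_commute_ofSubtype_fiber f F _)

theorem noncommProd_ofSubtype_fiber_apply (F : ∀ i, Perm {x // f x = i}) (s : Finset ι) (x : X) :
    s.noncommProd (fun i => Perm.ofSubtype (F i)) (pairwise_commute_ofSubtype_fiber f F _) x =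
      if f x ∈ s then (F (f x) ⟨x, rfl⟩ : X) else x := by
  induction s using Finset.induction_on with
  | empty => simp
  | insert i s hi ih =>
    rw [Finset.noncommProd_insert_of_notMem _ _ _ _ hi, Perm.mul_apply, ih]
    by_cases hxi : f x = i
    · subst hxi
      rw [if_neg hi, if_pos (Finset.mem_insert_self _ _)]
      exact Perm.ofSubtype_apply_of_mem (F (f x)) rfl
    by_cases hs : f x ∈ s
    · rw [if_pos hs, if_pos (Finset.mem_insert_of_mem hs), Perm.ofSubtype_apply_of_not_mem]
      rwa [(F (f x) ⟨x, rfl⟩).2]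
    · rw [if_neg hs, if_neg (by simp [hxi, hs])]
      exact Perm.ofSubtype_apply_of_not_mem (F i) hxi

theorem ofFibers_apply [Fintype ι] (F : ∀ i, Perm {x // f x = i}) (x : X) :
    ofFibers f F x = F (f x) ⟨x, rfl⟩ := by
  rw [ofFibers, noncommProd_ofSubtype_fiber_apply, if_pos (Finset.mem_univ _)]

variable [Fintype ι] [Fintype X] [DecidableEq X]

theorem parts_partition_ofFibers (F : ∀ i, Perm {x // f x = i}) :
    (ofFibers f F).partition.parts = ∑ i, (F i).partition.parts := by
  have htype : (ofFibers f F).cycleType = ∑ i, (F i).cycleType := by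
    rw [ofFibers, Perm.Disjoint.cycleType_noncommProd fun _ _ _ _ h =>
      disjoint_ofSubtype_fiber f F h]
    simp only [Perm.cycleType_ofSubtype]
  have hcard : Fintype.card X = ∑ i, Fintype.card {x // f x = i} := by
    rw [← Fintype.card_sigma]
    exact Fintype.card_congr (Equiv.sigmaFiberEquiv f).symm
  simp only [Perm.parts_partition, ← Perm.sum_cycleType, Finset.sum_add_distrib]
  rw [htype, hcard]
  congr 1
  simp only [← Multiset.nsmul_singleton]
  rw [Finset.sum_nsmul_assoc, ← Multiset.coe_sumAddMonoidHom, map_sum, Finset.sum_tsub_distrib]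
  exact fun i _ => (F i).sum_cycleType_le

theorem cycleMonomial_ofFibers (F : ∀ i, Perm {x // f x = i}) :
    cycleMonomial (ofFibers f F) = ∏ i, cycleMonomial (F i) := by
  simp only [cycleMonomial, cycleExp]
  rw [parts_partition_ofFibers, map_sum SymFun.powerExp, ← MvPolynomial.monomial_sum_one]

theorem sum_preserving_eq_sum_ofFibers {M : Type*} [AddCommMonoid M] (φ : Perm X → M) :
    ∑ g ∈ Finset.univ.filter (fun g : Perm X => ∀ x, f (g x) = f x), φ g =
      ∑ F : ∀ i, Perm {x // f x = i}, φ (ofFibers f F) := by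
  symm
  refine Finset.sum_bij (fun F _ => ofFibers f F) (fun F _ => ?_) (fun F _ G _ h => ?_)
    (fun g hg => ?_) fun _ _ => rfl
  · refine Finset.mem_filter.2 ⟨Finset.mem_univ _, fun x => ?_⟩
    rw [ofFibers_apply]
    exact (F (f x) ⟨x, rfl⟩).2
  · ext i ⟨x, rfl⟩
    simpa only [ofFibers_apply] using Perm.congr_fun h x
  · have hpres := (Finset.mem_filter.1 hg).2
    refine ⟨fun i => g.subtypePerm fun x => by rw [hpres], Finset.mem_univ _, ?_⟩
    ext x
    rw [ofFibers_apply]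
    rfl

theorem card_filter_preserving :
    (Finset.univ.filter fun g : Perm X => ∀ x, f (g x) = f x).card =
      ∏ i, (Fintype.card {x // f x = i}).factorial := by
  rw [← Fintype.card_subtype, ← DomMulAct.stabilizer_card f]
  exact Fintype.card_congr (Equiv.subtypeEquivRight fun g => funext_iff.symm)

theorem sum_preserving_cycleMonomial :
    ∑ g ∈ Finset.univ.filter (fun g : Perm X => ∀ x, f (g x) = f x), cycleMonomial g =
      (∏ i, ((Fintype.card {x // f x = i}).factorial : ℝ)) •
        ∏ i, SymFun.complete (Fintype.card {x // f x = i}) := by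
  rw [sum_preserving_eq_sum_ofFibers]
  simp only [cycleMonomial_ofFibers]
  rw [← Fintype.piFinset_univ, ← Finset.prod_univ_sum]
  simp only [sum_cycleMonomial, MvPolynomial.smul_eq_C_mul]
  rw [Finset.prod_mul_distrib, map_prod]

theorem sum_preserving_eq_pairing {χ : Perm X → ℝ} (hχ : ∀ g h, IsConj g h → χ g = χ h) :
    ∑ g ∈ Finset.univ.filter (fun g : Perm X => ∀ x, f (g x) = f x), χ g =
      (∏ i, ((Fintype.card {x // f x = i}).factorial : ℝ)) *
        SymFun.pairing (charMap χ) (∏ i, SymFun.complete (Fintype.card {x // f x = i})) := by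
  rw [← smul_eq_mul, ← map_smul, ← sum_preserving_cycleMonomial, map_sum]
  exact Finset.sum_congr rfl fun g _ => (pairing_charMap_cycleMonomial hχ g).symm

end Fibers

end SymmetricGroup

namespace YoungGraph

/-! ### Young symmetrizers -/

variable {lam : YoungDiagram}

/-- A labelling of the boxes which takes distinct values on the boxes of each column; these are the
labellings which are not annihilated by the column antisymmetrizer. -/
def IsColumnInjective {ι : Type*} (label : lam.cells → ι) : Prop :=
  ∀ x y, x.1.2 = y.1.2 → label x = label y → x = y

theorem card_filter_fst_lt_column (i j : ℕ) :
    (Finset.univ.filter fun x : lam.cells => x.1.2 = j ∧ x.1.1 < i).card =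
      min i (lam.colLen j) := by
  rw [← Finset.card_range (min i (lam.colLen j))]
  refine Finset.card_bij (fun x _ => x.1.1) ?_ ?_ ?_
  · rintro ⟨⟨r, c⟩, hmem⟩ hx
    obtain ⟨-, rfl, hr⟩ := Finset.mem_filter.1 hx
    exact Finset.mem_range.2 (lt_min hr (YoungDiagram.mem_iff_lt_colLen.1 hmem))
  · intro x hx y hy hxy
    exact Subtype.ext (Prod.ext hxy
      ((Finset.mem_filter.1 hx).2.1.trans (Finset.mem_filter.1 hy).2.1.symm))
  · intro k hk
    obtain ⟨hki, hkj⟩ := lt_min_iff.1 (Finset.mem_range.1 hk)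
    exact ⟨⟨(k, j), YoungDiagram.mem_iff_lt_colLen.2 hkj⟩,
      Finset.mem_filter.2 ⟨Finset.mem_univ _, rfl, hki⟩, rfl⟩

theorem card_filter_eq_sum_columns (label : lam.cells → ℕ) (i : ℕ) :
    (Finset.univ.filter fun x => label x < i).card =
      ∑ j ∈ Finset.univ.image (fun x : lam.cells => x.1.2),
        (Finset.univ.filter fun x : lam.cells => x.1.2 = j ∧ label x < i).card := by
  rw [Finset.card_eq_sum_card_fiberwise (f := fun x : lam.cells => x.1.2)
    fun x _ => Finset.mem_coe.2 (Finset.mem_image.2 ⟨x, Finset.mem_univ x, rfl⟩)]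
  simp only [Finset.filter_filter, and_comm]

namespace IsColumnInjective

variable {label : lam.cells → ℕ}

theorem card_filter_column_le (hl : IsColumnInjective label) (i j : ℕ) :
    (Finset.univ.filter fun x : lam.cells => x.1.2 = j ∧ label x < i).card ≤
      (Finset.univ.filter fun x : lam.cells => x.1.2 = j ∧ x.1.1 < i).card := by
  rw [card_filter_fst_lt_column]
  refine le_min ?_ ?_
  · conv_rhs => rw [← Finset.card_range i]
    refine Finset.card_le_card_of_injOn label
      (fun x hx => Finset.mem_coe.2 (Finset.mem_range.2 (Finset.mem_filter.1 hx).2.2)) ?_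
    exact fun x hx y hy hxy => hl x y
      ((Finset.mem_filter.1 hx).2.1.trans (Finset.mem_filter.1 hy).2.1.symm) hxy
  · rw [← min_self (lam.colLen j), ← card_filter_fst_lt_column]
    refine Finset.card_le_card fun x hx => ?_
    obtain ⟨-, rfl, -⟩ := Finset.mem_filter.1 hx
    exact Finset.mem_filter.2
      ⟨Finset.mem_univ _, rfl, YoungDiagram.mem_iff_lt_colLen.1 x.2⟩

theorem card_filter_lt_le (hl : IsColumnInjective label) (i : ℕ) :
    (Finset.univ.filter fun x => label x < i).card ≤
      (Finset.univ.filter fun x : lam.cells => x.1.1 < i).card := by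
  rw [card_filter_eq_sum_columns, card_filter_eq_sum_columns fun x => x.1.1]
  exact Finset.sum_le_sum fun j _ => hl.card_filter_column_le i j

theorem lt_colLen (hl : IsColumnInjective label)
    (hcard : ∀ i, (Finset.univ.filter fun x => label x < i).card =
      (Finset.univ.filter fun x : lam.cells => x.1.1 < i).card) (x : lam.cells) :
    label x < lam.colLen x.1.2 := by
  have hcolumn : (Finset.univ.filter fun y : lam.cells =>
        y.1.2 = x.1.2 ∧ label y < lam.colLen x.1.2).card =
      (Finset.univ.filter fun y : lam.cells =>
        y.1.2 = x.1.2 ∧ y.1.1 < lam.colLen x.1.2).card := by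
    have hsum := hcard (lam.colLen x.1.2)
    rw [card_filter_eq_sum_columns, card_filter_eq_sum_columns fun x => x.1.1] at hsum
    exact (Finset.sum_eq_sum_iff_of_le fun j _ => hl.card_filter_column_le _ j).1 hsum _
      (Finset.mem_image_of_mem _ (Finset.mem_univ x))
  have hsubset : (Finset.univ.filter fun y : lam.cells =>
        y.1.2 = x.1.2 ∧ label y < lam.colLen x.1.2) ⊆
      Finset.univ.filter fun y : lam.cells => y.1.2 = x.1.2 ∧ y.1.1 < lam.colLen x.1.2 := by
    refine Finset.monotone_filter_right _ fun y _ hy => ⟨hy.1, ?_⟩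
    rw [← hy.1]
    exact YoungDiagram.mem_iff_lt_colLen.1 y.2
  have hx : x ∈ Finset.univ.filter fun y : lam.cells =>
      y.1.2 = x.1.2 ∧ y.1.1 < lam.colLen x.1.2 :=
    Finset.mem_filter.2 ⟨Finset.mem_univ _, rfl, YoungDiagram.mem_iff_lt_colLen.1 x.2⟩
  rw [← Finset.eq_of_subset_of_card_le hsubset hcolumn.ge] at hx
  exact (Finset.mem_filter.1 hx).2.2

end IsColumnInjective

end YoungGraph

namespace SymmetricGroup

open MonoidAlgebra YoungGraph

theorem card_filter_comp_perm {X : Type*} [Fintype X] (g : Equiv.Perm X) (p : X → Prop)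
    [DecidablePred p] : (Finset.univ.filter fun x => p (g x)).card =
      (Finset.univ.filter p).card := by
  rw [← Fintype.card_subtype, ← Fintype.card_subtype]
  exact Fintype.card_congr (g.subtypeEquiv fun _ => Iff.rfl)

section ColorSymmetrizer

variable {X ι : Type*} [Fintype X] [DecidableEq X] [DecidableEq ι]

/-- The sum of the permutations which preserve a colouring. -/
def colorSymmetrizer (f : X → ι) : MonoidAlgebra ℝ (Equiv.Perm X) :=
  ∑ g ∈ Finset.univ.filter (fun g : Equiv.Perm X => ∀ x, f (g x) = f x), of ℝ _ g

theorem colorSymmetrizer_congr {κ : Type*} [DecidableEq κ] {f : X → ι} {f' : X → κ}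
    (h : ∀ x y, f x = f y ↔ f' x = f' y) : colorSymmetrizer f = colorSymmetrizer f' := by
  simp only [colorSymmetrizer, h]

theorem colorSymmetrizer_mul_of {f : X → ι} {r : Equiv.Perm X} (hr : ∀ x, f (r x) = f x) :
    colorSymmetrizer f * of ℝ _ r = colorSymmetrizer f := by
  rw [colorSymmetrizer, Finset.sum_mul]
  refine Finset.sum_equiv (Equiv.mulRight r) (fun g => ?_) fun g _ => (map_mul _ g r).symm
  simp only [Finset.mem_filter, Finset.mem_univ, true_and, Equiv.coe_mulRight,
    Equiv.Perm.mul_apply]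
  refine ⟨fun h x => (h (r x)).trans (hr x), fun h x => ?_⟩
  obtain ⟨y, rfl⟩ := r.surjective x
  exact (h y).trans (hr y).symm

theorem colorSymmetrizer_mul_self (f : X → ι) :
    colorSymmetrizer f * colorSymmetrizer f =
      ((Finset.univ.filter fun g : Equiv.Perm X => ∀ x, f (g x) = f x).card : ℝ) •
        colorSymmetrizer f := by
  conv_lhs => rhs; rw [colorSymmetrizer]
  rw [Finset.mul_sum, Finset.sum_congr rfl fun r hr =>
    colorSymmetrizer_mul_of (Finset.mem_filter.1 hr).2, Finset.sum_const, Nat.cast_smul_eq_nsmul]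

end ColorSymmetrizer

variable {lam : YoungDiagram}

theorem rowSymmetrizer_eq :
    rowSymmetrizer lam = colorSymmetrizer fun x : lam.cells => x.1.1 := by
  rw [rowSymmetrizer, colorSymmetrizer]

theorem of_mul_colAntisymmetrizer {c : BoxPerm lam} (hc : ∀ x, (c x).1.2 = x.1.2) :
    of ℝ _ c * colAntisymmetrizer lam =
      ((Equiv.Perm.sign c : ℤ) : ℝ) • colAntisymmetrizer lam := by
  have sign_sq : ((Equiv.Perm.sign c : ℤ) : ℝ) * ((Equiv.Perm.sign c : ℤ) : ℝ) = 1 := by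
    rw [← Int.cast_mul, ← Units.val_mul, Int.units_mul_self, Units.val_one, Int.cast_one]
  rw [colAntisymmetrizer, Finset.mul_sum, Finset.smul_sum]
  refine Finset.sum_equiv (Equiv.mulLeft c) (fun g => ?_) fun g _ => ?_
  · simp only [Finset.mem_filter, Finset.mem_univ, true_and, Equiv.coe_mulLeft,
      Equiv.Perm.mul_apply, hc]
  · rw [mul_smul_comm, ← map_mul, smul_smul, Equiv.coe_mulLeft, Equiv.Perm.sign_mul, Units.val_mul,
      Int.cast_mul, ← mul_assoc, sign_sq, one_mul]

/-- If `x` and `y` lie in one column and `g x` and `g y` have one colour, then moving the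
transposition `(g x, g y)` through `g` changes the sign of the product. -/
theorem colorSymmetrizer_mul_of_mul_eq_zero {ι : Type*} [DecidableEq ι] {f : lam.cells → ι}
    {g : BoxPerm lam} (h : ¬ IsColumnInjective fun x => f (g x)) :
    colorSymmetrizer f * of ℝ _ g * colAntisymmetrizer lam = 0 := by
  rw [IsColumnInjective] at h
  push Not at h
  obtain ⟨x, y, hcol, hcolor, hne⟩ := h
  have := IsAddTorsionFree.of_isTorsionFree ℝ (MonoidAlgebra ℝ (BoxPerm lam))
  refine self_eq_neg.1 ?_
  calc colorSymmetrizer f * of ℝ _ g * colAntisymmetrizer lam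
      = colorSymmetrizer f * of ℝ _ (Equiv.swap (g x) (g y) * g) * colAntisymmetrizer lam := by
        rw [map_mul, ← mul_assoc, colorSymmetrizer_mul_of (Equiv.apply_swap_eq_self hcolor)]
    _ = colorSymmetrizer f * of ℝ _ g * (of ℝ _ (Equiv.swap x y) * colAntisymmetrizer lam) := by
        rw [← Equiv.mul_swap_eq_swap_mul, map_mul, ← mul_assoc, ← mul_assoc]
    _ = -(colorSymmetrizer f * of ℝ _ g * colAntisymmetrizer lam) := by
        rw [of_mul_colAntisymmetrizer
          (Equiv.apply_swap_eq_self (v := fun z : lam.cells => z.1.2) hcol),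
          Equiv.Perm.sign_swap hne]
        simp

theorem mul_eq_one_iff_of_row_of_column {r c : BoxPerm lam} (hr : ∀ x, (r x).1.1 = x.1.1)
    (hc : ∀ x, (c x).1.2 = x.1.2) : r * c = 1 ↔ r = 1 ∧ c = 1 := by
  refine ⟨fun h => ?_, fun h => by rw [h.1, h.2, mul_one]⟩
  have hc_one : c = 1 := by
    ext1 x
    refine Subtype.ext (Prod.ext ?_ (hc x))
    rw [← hr, ← Equiv.Perm.mul_apply, h]
  exact ⟨by rwa [hc_one, mul_one] at h, hc_one⟩

theorem coeff_one_youngSymmetrizer : (youngSymmetrizer lam).coeff 1 = 1 := by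
  classical
  rw [youngSymmetrizer, rowSymmetrizer, colAntisymmetrizer, Finset.sum_mul_sum,
    ← Finset.sum_product', coeff_sum, Finset.sum_apply',
    Finset.sum_eq_single_of_mem (1, 1) (by simp)]
  · simp
  · rintro ⟨r, c⟩ hmem hne
    obtain ⟨hr, hc⟩ := Finset.mem_product.1 hmem
    have hrc : r * c ≠ 1 := fun h => hne (Prod.ext_iff.2
      ((mul_eq_one_iff_of_row_of_column (Finset.mem_filter.1 hr).2 (Finset.mem_filter.1 hc).2).1 h))
    rw [mul_smul_comm, ← map_mul, coeff_smul_apply, of_apply, coeff_single,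
      Finsupp.single_eq_of_ne hrc.symm, smul_zero]

theorem exists_eq_mul_of_isColumnInjective {g : BoxPerm lam}
    (h : IsColumnInjective fun x => (g x).1.1) : ∃ r c : BoxPerm lam,
      (∀ x, (r x).1.1 = x.1.1) ∧ (∀ x, (c x).1.2 = x.1.2) ∧ g = r * c := by
  let column : lam.cells → lam.cells := fun x => ⟨((g x).1.1, x.1.2),
    YoungDiagram.mem_iff_lt_colLen.2
      (h.lt_colLen (fun i => card_filter_comp_perm g fun x => x.1.1 < i) x)⟩
  have column_injective : Function.Injective column := fun x y hxy =>
    have hcells : ((g x).1.1, x.1.2) = ((g y).1.1, y.1.2) := congrArg Subtype.val hxy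
    h x y (Prod.ext_iff.1 hcells).2 (Prod.ext_iff.1 hcells).1
  let c : BoxPerm lam :=
    Equiv.ofBijective column (Finite.injective_iff_bijective.1 column_injective)
  refine ⟨g * c⁻¹, c, fun x => ?_, fun x => rfl, (inv_mul_cancel_right g c).symm⟩
  obtain ⟨y, rfl⟩ := c.surjective x
  exact congrArg (fun z => (g z).1.1) (c.symm_apply_apply y)

theorem exists_rowSymmetrizer_mul_of_mul (g : BoxPerm lam) :
    ∃ s : ℝ, rowSymmetrizer lam * of ℝ _ g * colAntisymmetrizer lam =
      s • youngSymmetrizer lam := by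
  by_cases h : IsColumnInjective fun x => (g x).1.1
  · obtain ⟨r, c, hr, hc, rfl⟩ := exists_eq_mul_of_isColumnInjective h
    refine ⟨((Equiv.Perm.sign c : ℤ) : ℝ), ?_⟩
    rw [map_mul, ← mul_assoc, youngSymmetrizer, rowSymmetrizer_eq, colorSymmetrizer_mul_of hr,
      mul_assoc, of_mul_colAntisymmetrizer hc, mul_smul_comm]
  · refine ⟨0, ?_⟩
    rw [zero_smul, rowSymmetrizer_eq, colorSymmetrizer_mul_of_mul_eq_zero h]

/-- The coefficient at the identity of `R x C`, where `R` and `C` are the row symmetrizer and the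
column antisymmetrizer; by von Neumann's lemma `R x C` is this multiple of the Young symmetrizer. -/
def sandwichCoeff (lam : YoungDiagram) : MonoidAlgebra ℝ (BoxPerm lam) →ₗ[ℝ] ℝ where
  toFun x := (rowSymmetrizer lam * x * colAntisymmetrizer lam).coeff 1
  map_add' x y := by rw [mul_add, add_mul, coeff_add, Finsupp.add_apply]
  map_smul' a x := by
    rw [mul_smul_comm, smul_mul_assoc, coeff_smul_apply, RingHom.id_apply]

theorem sandwichCoeff_eq_of_eq_smul {x : MonoidAlgebra ℝ (BoxPerm lam)} {s : ℝ}
    (h : rowSymmetrizer lam * x * colAntisymmetrizer lam = s • youngSymmetrizer lam) :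
    sandwichCoeff lam x = s := by
  change (rowSymmetrizer lam * x * colAntisymmetrizer lam).coeff 1 = s
  rw [h, coeff_smul_apply, coeff_one_youngSymmetrizer, smul_eq_mul, mul_one]

theorem rowSymmetrizer_mul_mul (x : MonoidAlgebra ℝ (BoxPerm lam)) :
    rowSymmetrizer lam * x * colAntisymmetrizer lam =
      sandwichCoeff lam x • youngSymmetrizer lam := by
  induction x using MonoidAlgebra.induction_on with
  | of g =>
    obtain ⟨s, hs⟩ := exists_rowSymmetrizer_mul_of_mul g
    rw [sandwichCoeff_eq_of_eq_smul hs, hs]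
  | add x y hx hy => rw [mul_add, add_mul, hx, hy, map_add, add_smul]
  | smul a x hx => rw [mul_smul_comm, smul_mul_assoc, hx, map_smul, smul_eq_mul, mul_smul]

/-- The number `n` with `e * e = n • e` for the Young symmetrizer `e`; it is the product of the
hook lengths, although only `n ≠ 0` matters here. -/
def hookFactor (lam : YoungDiagram) : ℝ :=
  sandwichCoeff lam (colAntisymmetrizer lam * rowSymmetrizer lam)

theorem youngSymmetrizer_mul_self : youngSymmetrizer lam * youngSymmetrizer lam =
    hookFactor lam • youngSymmetrizer lam := by
  rw [hookFactor, ← rowSymmetrizer_mul_mul, youngSymmetrizer]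
  simp only [mul_assoc]

/-! ### The characters of the Specht modules -/

theorem trace_eq_sum_coeff {G : Type*} [Fintype G]
    (f : MonoidAlgebra ℝ G →ₗ[ℝ] MonoidAlgebra ℝ G) :
    LinearMap.trace ℝ (MonoidAlgebra ℝ G) f = ∑ g, (f (single g 1)).coeff g := by
  classical
  rw [LinearMap.trace_eq_matrix_trace ℝ (MonoidAlgebra.basis G ℝ), Matrix.trace]
  refine Finset.sum_congr rfl fun g _ => ?_
  rw [Matrix.diag_apply, LinearMap.toMatrix_apply, MonoidAlgebra.basis_apply]
  rfl

/-- The trace of `x ↦ y x e` on the group algebra, where `e` is the Young symmetrizer. Since `e` is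
`hookFactor lam` times a projection onto the Specht module, this is `hookFactor lam` times the
linear extension of the character `irrChar lam`. -/
def symmetrizerTrace (lam : YoungDiagram) : MonoidAlgebra ℝ (BoxPerm lam) →ₗ[ℝ] ℝ :=
  LinearMap.trace ℝ _ ∘ₗ LinearMap.lcomp ℝ _ (LinearMap.mulRight ℝ (youngSymmetrizer lam)) ∘ₗ
    LinearMap.mul ℝ _

theorem symmetrizerTrace_apply (y : MonoidAlgebra ℝ (BoxPerm lam)) :
    symmetrizerTrace lam y = LinearMap.trace ℝ _
      (LinearMap.mulLeft ℝ y ∘ₗ LinearMap.mulRight ℝ (youngSymmetrizer lam)) :=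
  rfl

theorem symmetrizerTrace_of (g : BoxPerm lam) : symmetrizerTrace lam (of ℝ _ g) =
    ∑ h : BoxPerm lam, (youngSymmetrizer lam).coeff (h⁻¹ * g⁻¹ * h) := by
  rw [symmetrizerTrace_apply, trace_eq_sum_coeff]
  refine Finset.sum_congr rfl fun h _ => ?_
  rw [LinearMap.comp_apply, LinearMap.mulLeft_apply, LinearMap.mulRight_apply, ← mul_assoc,
    ← of_apply, ← map_mul, of_apply, coeff_single_mul_apply, one_mul, mul_inv_rev]

theorem hookFactor_ne_zero : hookFactor lam ≠ 0 := by
  intro hzero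
  have hnil : IsNilpotent (LinearMap.mulRight ℝ (youngSymmetrizer lam)) := by
    refine ⟨2, ?_⟩
    rw [LinearMap.pow_mulRight, pow_two, youngSymmetrizer_mul_self, hzero, zero_smul,
      LinearMap.mulRight_zero_eq_zero]
  have htrace : symmetrizerTrace lam (of ℝ _ 1) = 0 := by
    rw [symmetrizerTrace_apply, map_one, LinearMap.mulLeft_one, LinearMap.id_comp]
    exact (LinearMap.isNilpotent_trace_of_isNilpotent hnil).eq_zero
  rw [symmetrizerTrace_of] at htrace
  simp [coeff_one_youngSymmetrizer, Fintype.card_ne_zero] at htrace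

theorem irrChar_eq_symmetrizerTrace (g : BoxPerm lam) :
    irrChar lam g = (hookFactor lam)⁻¹ * symmetrizerTrace lam (of ℝ _ g) := by
  rw [symmetrizerTrace_apply, ← smul_eq_mul, ← map_smul]
  have hmem : ∀ x, ((hookFactor lam)⁻¹ • (LinearMap.mulLeft ℝ (of ℝ (BoxPerm lam) g) ∘ₗ
      LinearMap.mulRight ℝ (youngSymmetrizer lam))) x ∈ spechtModule lam := fun x =>
    Submodule.smul_mem _ _ ⟨of ℝ (BoxPerm lam) g * x, mul_assoc _ _ _⟩
  rw [← LinearMap.trace_restrict_eq_of_forall_mem (spechtModule lam) _ hmem]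
  refine congrArg (LinearMap.trace ℝ (spechtModule lam)) (LinearMap.ext ?_)
  rintro ⟨_, z, rfl⟩
  refine Subtype.ext ?_
  change of ℝ (BoxPerm lam) g * (z * youngSymmetrizer lam) = (hookFactor lam)⁻¹ •
    (of ℝ (BoxPerm lam) g * (z * youngSymmetrizer lam * youngSymmetrizer lam))
  rw [mul_assoc z, youngSymmetrizer_mul_self, mul_smul_comm, mul_smul_comm,
    inv_smul_smul₀ hookFactor_ne_zero]

theorem sum_irrChar_mul_coeff (y : MonoidAlgebra ℝ (BoxPerm lam)) :
    ∑ g, irrChar lam g * y.coeff g = (hookFactor lam)⁻¹ * symmetrizerTrace lam y := by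
  induction y using MonoidAlgebra.induction_on with
  | of g =>
    rw [← irrChar_eq_symmetrizerTrace, Finset.sum_eq_single_of_mem g (Finset.mem_univ g)]
    · simp
    · intro h _ hne
      rw [of_apply, coeff_single, Finsupp.single_eq_of_ne hne, mul_zero]
  | add x y hx hy =>
    rw [map_add, mul_add, ← hx, ← hy, ← Finset.sum_add_distrib]
    simp only [coeff_add, Finsupp.add_apply, mul_add]
  | smul a x hx =>
    rw [map_smul, smul_eq_mul, mul_left_comm, ← hx, Finset.mul_sum]
    simp only [coeff_smul_apply, smul_eq_mul, mul_left_comm]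

theorem symmetrizerTrace_eq_zero {y : MonoidAlgebra ℝ (BoxPerm lam)}
    (h : ∀ g : BoxPerm lam, y * of ℝ _ g * colAntisymmetrizer lam = 0) :
    symmetrizerTrace lam y = 0 := by
  have hmul : ∀ x, y * x * colAntisymmetrizer lam = 0 := by
    intro x
    induction x using MonoidAlgebra.induction_on with
    | of g => exact h g
    | add x z hx hz => rw [mul_add, add_mul, hx, hz, add_zero]
    | smul a x hx => rw [mul_smul_comm, smul_mul_assoc, hx, smul_zero]
  rw [symmetrizerTrace_apply, ← map_zero (LinearMap.trace ℝ (MonoidAlgebra ℝ (BoxPerm lam)))]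
  refine congrArg _ (LinearMap.ext fun x => ?_)
  rw [LinearMap.comp_apply, LinearMap.mulLeft_apply, LinearMap.mulRight_apply, youngSymmetrizer,
    ← mul_assoc, ← mul_assoc, mul_assoc y, hmul, LinearMap.zero_apply]

/-- By von Neumann's lemma `x ↦ R z x e` has rank at most one. -/
theorem symmetrizerTrace_rowSymmetrizer_mul (z : MonoidAlgebra ℝ (BoxPerm lam)) :
    symmetrizerTrace lam (rowSymmetrizer lam * z) =
      sandwichCoeff lam (z * youngSymmetrizer lam * rowSymmetrizer lam) := by
  have hrank : LinearMap.mulLeft ℝ (rowSymmetrizer lam * z) ∘ₗ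
      LinearMap.mulRight ℝ (youngSymmetrizer lam) =
      (sandwichCoeff lam ∘ₗ LinearMap.mulLeft ℝ z ∘ₗ
        LinearMap.mulRight ℝ (rowSymmetrizer lam)).smulRight (youngSymmetrizer lam) := by
    refine LinearMap.ext fun x => ?_
    simp only [LinearMap.smulRight_apply, LinearMap.comp_apply, LinearMap.mulLeft_apply,
      LinearMap.mulRight_apply]
    rw [← rowSymmetrizer_mul_mul, youngSymmetrizer]
    simp only [mul_assoc]
  rw [symmetrizerTrace_apply, hrank, LinearMap.trace_smulRight]
  simp only [LinearMap.comp_apply, LinearMap.mulLeft_apply, LinearMap.mulRight_apply, mul_assoc]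

theorem symmetrizerTrace_youngSymmetrizer :
    symmetrizerTrace lam (youngSymmetrizer lam) = hookFactor lam * hookFactor lam := by
  conv_lhs => rw [youngSymmetrizer, symmetrizerTrace_rowSymmetrizer_mul]
  refine sandwichCoeff_eq_of_eq_smul ?_
  calc rowSymmetrizer lam * (colAntisymmetrizer lam * youngSymmetrizer lam * rowSymmetrizer lam) *
        colAntisymmetrizer lam
      = youngSymmetrizer lam * youngSymmetrizer lam * youngSymmetrizer lam := by
        simp only [youngSymmetrizer, mul_assoc]
    _ = (hookFactor lam * hookFactor lam) • youngSymmetrizer lam := by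
        rw [youngSymmetrizer_mul_self, smul_mul_assoc, youngSymmetrizer_mul_self, mul_smul]

theorem irrChar_eq_of_isConj (g h : BoxPerm lam) (hgh : IsConj g h) :
    irrChar lam g = irrChar lam h := by
  obtain ⟨k, rfl⟩ := isConj_iff.1 hgh
  exact ((spechtRep lam).char_conj g k).symm

theorem sum_irrChar_mul_coeff_conj (h : BoxPerm lam) :
    ∑ g : BoxPerm lam, irrChar lam g * (youngSymmetrizer lam).coeff (h⁻¹ * g⁻¹ * h) =
      hookFactor lam := by
  have hsum : ∑ g, irrChar lam g * (youngSymmetrizer lam).coeff g = hookFactor lam := by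
    rw [sum_irrChar_mul_coeff, symmetrizerTrace_youngSymmetrizer,
      inv_mul_cancel_left₀ hookFactor_ne_zero]
  rw [← hsum]
  refine Fintype.sum_equiv ((Equiv.inv (BoxPerm lam)).trans (MulAut.conj h⁻¹).toEquiv) _ _
    fun g => ?_
  have happly : ((Equiv.inv (BoxPerm lam)).trans (MulAut.conj h⁻¹).toEquiv) g =
      h⁻¹ * g⁻¹ * h := by simp
  have hinv : IsConj g g⁻¹ :=
    Equiv.Perm.isConj_iff_cycleType_eq.2 (Equiv.Perm.cycleType_inv g).symm
  have hconj : IsConj g⁻¹ (h⁻¹ * g⁻¹ * h) := isConj_iff.2 ⟨h⁻¹, by rw [inv_inv]⟩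
  rw [happly, irrChar_eq_of_isConj _ _ (hinv.trans hconj)]

theorem sum_irrChar_mul_self :
    ∑ g, irrChar lam g * irrChar lam g = (Fintype.card (BoxPerm lam) : ℝ) :=
  calc ∑ g, irrChar lam g * irrChar lam g
      = ∑ g, (hookFactor lam)⁻¹ * ∑ h : BoxPerm lam,
          irrChar lam g * (youngSymmetrizer lam).coeff (h⁻¹ * g⁻¹ * h) := by
        refine Finset.sum_congr rfl fun g _ => ?_
        rw [← Finset.mul_sum, ← symmetrizerTrace_of, mul_left_comm, ← irrChar_eq_symmetrizerTrace]
    _ = (hookFactor lam)⁻¹ * ∑ h : BoxPerm lam, ∑ g : BoxPerm lam,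
          irrChar lam g * (youngSymmetrizer lam).coeff (h⁻¹ * g⁻¹ * h) := by
        rw [Finset.sum_comm, Finset.mul_sum]
    _ = (Fintype.card (BoxPerm lam) : ℝ) := by
        simp only [sum_irrChar_mul_coeff_conj, Finset.sum_const, Finset.card_univ, nsmul_eq_mul]
        rw [mul_left_comm, inv_mul_cancel₀ hookFactor_ne_zero, mul_one]

theorem sum_preserving_irrChar {ι : Type*} [DecidableEq ι] (f : lam.cells → ι) :
    ∑ g ∈ Finset.univ.filter (fun g : BoxPerm lam => ∀ x, f (g x) = f x), irrChar lam g =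
      (hookFactor lam)⁻¹ * symmetrizerTrace lam (colorSymmetrizer f) := by
  simp only [irrChar_eq_symmetrizerTrace, colorSymmetrizer, map_sum, Finset.mul_sum]

theorem sum_preserving_irrChar_of_row {ι : Type*} [DecidableEq ι] {f : lam.cells → ι}
    (hf : ∀ x y, f x = f y ↔ x.1.1 = y.1.1) :
    ∑ g ∈ Finset.univ.filter (fun g : BoxPerm lam => ∀ x, f (g x) = f x), irrChar lam g =
      ((Finset.univ.filter (fun g : BoxPerm lam => ∀ x, f (g x) = f x)).card : ℝ) := by
  have hrow : colorSymmetrizer f = rowSymmetrizer lam :=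
    (colorSymmetrizer_congr hf).trans rowSymmetrizer_eq.symm
  have htrace : symmetrizerTrace lam (rowSymmetrizer lam) =
      ((Finset.univ.filter (fun g : BoxPerm lam => ∀ x, f (g x) = f x)).card : ℝ) *
        hookFactor lam := by
    rw [← mul_one (rowSymmetrizer lam), symmetrizerTrace_rowSymmetrizer_mul, one_mul]
    refine sandwichCoeff_eq_of_eq_smul ?_
    rw [mul_smul, ← youngSymmetrizer_mul_self, youngSymmetrizer, ← smul_mul_assoc,
      ← smul_mul_assoc, ← hrow, ← colorSymmetrizer_mul_self]
    simp only [mul_assoc]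
  rw [sum_preserving_irrChar, hrow, htrace, mul_left_comm, inv_mul_cancel₀ hookFactor_ne_zero,
    mul_one]

open SymFun

theorem card_filter_lt_succ_eq_sum {X : Type*} [Fintype X] {N : ℕ} (f : X → Fin N) (i : Fin N) :
    (Finset.univ.filter fun x => (f x : ℕ) < i + 1).card =
      ∑ j ∈ Finset.Iic i, Fintype.card {x // f x = j} := by
  have hmem : ∀ x, f x ∈ Finset.Iic i ↔ (f x : ℕ) < i + 1 := fun x => by
    rw [Finset.mem_Iic, Fin.le_def, Nat.lt_succ_iff]
  rw [Finset.card_eq_sum_card_fiberwise (f := f) (t := Finset.Iic i)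
    fun x hx => (hmem x).2 (Finset.mem_filter.1 hx).2]
  refine Finset.sum_congr rfl fun j hj => ?_
  rw [Fintype.card_subtype, Finset.filter_filter]
  refine congrArg Finset.card (Finset.filter_congr fun x _ => and_iff_right_of_imp ?_)
  rintro rfl
  exact (hmem x).1 hj

theorem exists_card_fiber_eq {X ι : Type*} [Fintype X] [Fintype ι] [DecidableEq ι] {b : ι → ℕ}
    (hb : ∑ i, b i = Fintype.card X) :
    ∃ f : X → ι, ∀ i, Fintype.card {x // f x = i} = b i := by
  have hcard : Fintype.card X = Fintype.card (Σ i, Fin (b i)) := by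
    simp only [Fintype.card_sigma, Fintype.card_fin, hb]
  let e := Fintype.equivOfCardEq hcard
  refine ⟨fun x => (e x).1, fun i => ?_⟩
  have fiberEquiv : {x : X // (e x).1 = i} ≃ {s : Σ i, Fin (b i) // s.1 = i} :=
    e.subtypeEquiv fun x => Iff.rfl
  rw [Fintype.card_congr (fiberEquiv.trans (Equiv.sigmaSubtype i)), Fintype.card_fin]

/-- The colouring of the boxes by their row, with enough colours for every composition of
`lam.card` into as many parts. -/
def rowColor (lam : YoungDiagram) (x : lam.cells) : Fin lam.card :=
  ⟨x.1.1, fst_lt_card x.2⟩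

theorem card_rowColor_fiber (i : Fin lam.card) :
    Fintype.card {x // rowColor lam x = i} = lam.rowLen i := by
  rw [YoungDiagram.rowLen_eq_card, YoungDiagram.row, ← Fintype.card_coe]
  refine Fintype.card_congr (((Equiv.subtypeEquivRight fun x => Fin.ext_iff).trans
    (Equiv.subtypeSubtypeEquivSubtypeInter (· ∈ lam.cells) fun c => c.1 = i)).trans
    (Equiv.subtypeEquivRight fun c => Finset.mem_filter.symm))

theorem not_isColumnInjective_of_lt {f : lam.cells → Fin lam.card}
    (hf : toLex (fun i : Fin lam.card => lam.rowLen i) <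
      toLex fun i => Fintype.card {x // f x = i}) :
    ¬ IsColumnInjective f := by
  intro hinj
  obtain ⟨i, heq, hlt⟩ := toLex_lt_toLex.1 hf
  have hdom : ∑ j ∈ Finset.Iic i, Fintype.card {x // f x = j} ≤
      ∑ j ∈ Finset.Iic i, Fintype.card {x // rowColor lam x = j} := by
    rw [← card_filter_lt_succ_eq_sum, ← card_filter_lt_succ_eq_sum]
    exact IsColumnInjective.card_filter_lt_le
      (fun x y hcol hlabel => hinj x y hcol (Fin.ext hlabel)) (i + 1)
  refine hdom.not_gt (Finset.sum_lt_sum (fun j hj => ?_) ⟨i, Finset.mem_Iic.2 le_rfl, ?_⟩)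
  · rw [card_rowColor_fiber]
    rcases (Finset.mem_Iic.1 hj).lt_or_eq with hji | rfl
    · exact (heq j hji).le
    · exact hlt.le
  · rwa [card_rowColor_fiber]

theorem sum_preserving_irrChar_eq_zero {f : lam.cells → Fin lam.card}
    (hf : toLex (fun i : Fin lam.card => lam.rowLen i) <
      toLex fun i => Fintype.card {x // f x = i}) :
    ∑ g ∈ Finset.univ.filter (fun g : BoxPerm lam => ∀ x, f (g x) = f x), irrChar lam g = 0 := by
  rw [sum_preserving_irrChar, symmetrizerTrace_eq_zero fun g =>
    colorSymmetrizer_mul_of_mul_eq_zero (not_isColumnInjective_of_lt ?_), mul_zero]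
  convert hf using 3 with i
  exact Fintype.card_congr (g.subtypeEquiv fun _ => Iff.rfl)

theorem pairing_charMap_irrChar_self :
    pairing (charMap (irrChar lam)) (charMap (irrChar lam)) = 1 := by
  rw [pairing_charMap_self irrChar_eq_of_isConj, sum_irrChar_mul_self, Fintype.card_perm,
    inv_mul_cancel₀ (by positivity)]

theorem pairing_charMap_irrChar_schur : pairing (charMap (irrChar lam)) (schur lam) = 1 := by
  have prod_factorial_ne_zero : ∀ b : Fin lam.card → ℕ, ∏ i, ((b i).factorial : ℝ) ≠ 0 :=
    fun b => by positivity
  rw [schur_eq_jacobiTrudi rfl, apply_jacobiTrudi]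
  · have hrow := sum_preserving_eq_pairing (rowColor lam) irrChar_eq_of_isConj
    rw [sum_preserving_irrChar_of_row fun _ _ => Fin.ext_iff, card_filter_preserving] at hrow
    simp only [card_rowColor_fiber, Nat.cast_prod] at hrow
    exact (mul_eq_left₀ (prod_factorial_ne_zero _)).1 hrow.symm
  · intro b hb hlt
    rw [sum_rowLen] at hb
    obtain ⟨f, hf⟩ := exists_card_fiber_eq (hb.trans (Fintype.card_coe lam.cells).symm)
    have hzero := sum_preserving_eq_pairing f (irrChar_eq_of_isConj (lam := lam))
    rw [sum_preserving_irrChar_eq_zero (by simpa only [hf] using hlt)] at hzero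
    simp only [hf] at hzero
    exact (mul_eq_zero.1 hzero.symm).resolve_left (prod_factorial_ne_zero b)

/-- Both sides have norm one and their pairing is one. -/
theorem charMap_irrChar : charMap (irrChar lam) = schur lam := by
  rw [← sub_eq_zero]
  apply eq_zero_of_pairing_self
  simp only [map_sub, LinearMap.sub_apply]
  rw [pairing_comm (schur lam), pairing_charMap_irrChar_self, pairing_charMap_irrChar_schur,
    pairing_schur_self]
  norm_num

end SymmetricGroup

/-! ### Moments of Thoma measures and controlling measures -/

namespace ThomaSimplex

open ProbabilityTheory

theorem continuous_coordinates : Continuous fun ω : ThomaSimplex => (ω.α, ω.β) :=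
  continuous_induced_dom

theorem continuous_α (i : ℕ) : Continuous fun ω : ThomaSimplex => ω.α i :=
  (continuous_apply i).comp continuous_coordinates.fst

theorem continuous_β (i : ℕ) : Continuous fun ω : ThomaSimplex => ω.β i :=
  (continuous_apply i).comp continuous_coordinates.snd

theorem summable_α (ω : ThomaSimplex) : Summable ω.α :=
  .of_nonneg_of_le ω.α_nonneg (fun i => le_add_of_nonneg_right (ω.β_nonneg i)) ω.hasSum.summable

theorem summable_β (ω : ThomaSimplex) : Summable ω.β :=
  .of_nonneg_of_le ω.β_nonneg (fun i => le_add_of_nonneg_left (ω.α_nonneg i)) ω.hasSum.summable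

theorem tsum_add_tsum_add (ω : ThomaSimplex) : (∑' i, ω.α i) + (∑' i, ω.β i) + ω.γ = 1 := by
  rw [← ω.summable_α.tsum_add ω.summable_β, ω.hasSum.tsum_eq, sub_add_cancel]

/-- The coordinate `γ` is not continuous: mass of the `α_i` can escape to it in a limit. -/
theorem measurable_γ : Measurable ThomaSimplex.γ := by
  have γ_eq : ThomaSimplex.γ = fun ω =>
      1 - (∑' i, ENNReal.ofReal (ω.α i)).toReal - (∑' i, ENNReal.ofReal (ω.β i)).toReal := by
    funext ω
    rw [← ENNReal.ofReal_tsum_of_nonneg ω.α_nonneg ω.summable_α,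
      ← ENNReal.ofReal_tsum_of_nonneg ω.β_nonneg ω.summable_β,
      ENNReal.toReal_ofReal (tsum_nonneg ω.α_nonneg),
      ENNReal.toReal_ofReal (tsum_nonneg ω.β_nonneg)]
    linarith [ω.tsum_add_tsum_add]
  rw [γ_eq]
  refine (measurable_const.sub ?_).sub ?_
  · exact (Measurable.tsum fun i => (continuous_α i).measurable.ennreal_ofReal).ennreal_toReal
  · exact (Measurable.tsum fun i => (continuous_β i).measurable.ennreal_ofReal).ennreal_toReal

instance isProbabilityMeasure_thomaMeasure (ω : ThomaSimplex) :
    IsProbabilityMeasure (thomaMeasure ω) := by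
  constructor
  rw [thomaMeasure, Measure.add_apply, Measure.add_apply, Measure.sum_apply _ MeasurableSet.univ,
    Measure.sum_apply _ MeasurableSet.univ]
  simp only [Measure.smul_apply, measure_univ, smul_eq_mul, mul_one]
  rw [← ENNReal.ofReal_tsum_of_nonneg ω.α_nonneg ω.summable_α,
    ← ENNReal.ofReal_tsum_of_nonneg ω.β_nonneg ω.summable_β,
    ← ENNReal.ofReal_add (tsum_nonneg ω.α_nonneg) (tsum_nonneg ω.β_nonneg),
    ← ENNReal.ofReal_add (add_nonneg (tsum_nonneg ω.α_nonneg) (tsum_nonneg ω.β_nonneg))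
      ω.γ_nonneg, tsum_add_tsum_add, ENNReal.ofReal_one]

theorem measurable_thomaMeasure : Measurable thomaMeasure := by
  refine Measure.measurable_of_measurable_coe _ fun s hs => ?_
  simp only [thomaMeasure, Measure.add_apply, Measure.sum_apply _ hs, Measure.smul_apply,
    smul_eq_mul]
  have measurable_posPoint (i : ℕ) : Measurable fun ω : ThomaSimplex => ω.posPoint i :=
    ((continuous_α i).subtype_mk _).measurable
  have measurable_negPoint (i : ℕ) : Measurable fun ω : ThomaSimplex => ω.negPoint i :=
    ((continuous_β i).neg.subtype_mk _).measurable
  have measurable_dirac_apply : Measurable fun x : Set.Icc (-1 : ℝ) 1 => Measure.dirac x s :=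
    (Measure.measurable_coe hs).comp Measure.measurable_dirac
  refine .add (.add (.tsum fun i => ?_) (.tsum fun i => ?_)) ?_
  · exact (continuous_α i).measurable.ennreal_ofReal.mul
      (measurable_dirac_apply.comp (measurable_posPoint i))
  · exact (continuous_β i).measurable.ennreal_ofReal.mul
      (measurable_dirac_apply.comp (measurable_negPoint i))
  · exact measurable_γ.ennreal_ofReal.mul measurable_const

theorem measurable_pi_thomaMeasure (ι : Type*) [Fintype ι] :
    Measurable fun ω => Measure.pi fun _ : ι => thomaMeasure ω := by
  refine .measure_of_isPiSystem_of_isProbabilityMeasure generateFrom_pi.symm isPiSystem_pi ?_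
  rintro _ ⟨s, hs, rfl⟩
  simp only [Measure.pi_pi]
  refine Finset.measurable_prod _ fun i _ => ?_
  have measurableSet_s : MeasurableSet (s i) := hs i (Set.mem_univ i)
  exact (Measure.measurable_coe measurableSet_s).comp measurable_thomaMeasure

/-- The Thoma measures `ν_ω` as a Markov kernel. -/
def thomaKernel : Kernel ThomaSimplex (Set.Icc (-1 : ℝ) 1) :=
  ⟨thomaMeasure, measurable_thomaMeasure⟩

instance : IsMarkovKernel thomaKernel :=
  ⟨isProbabilityMeasure_thomaMeasure⟩

/-- The powers `ν_ω^{×n}` of the Thoma measures as a Markov kernel; composed with `P` it gives the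
`n`-th controlling measure. -/
def thomaPowKernel (n : ℕ) : Kernel ThomaSimplex (Fin n → Set.Icc (-1 : ℝ) 1) :=
  ⟨fun ω => Measure.pi fun _ => thomaMeasure ω, measurable_pi_thomaMeasure (Fin n)⟩

instance (n : ℕ) : IsMarkovKernel (thomaPowKernel n) :=
  ⟨fun ω => inferInstanceAs (IsProbabilityMeasure (Measure.pi fun _ => thomaMeasure ω))⟩

instance isProbabilityMeasure_controllingMeasure (P : Measure ThomaSimplex)
    [IsProbabilityMeasure P] (n : ℕ) : IsProbabilityMeasure (controllingMeasure P n) :=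
  inferInstanceAs (IsProbabilityMeasure (thomaPowKernel n ∘ₘ P))

theorem abs_pow_le_one (x : Set.Icc (-1 : ℝ) 1) (l : ℕ) : |(x : ℝ) ^ l| ≤ 1 := by
  rw [abs_pow]
  exact pow_le_one₀ (abs_nonneg _) (abs_le.2 x.2)

theorem integral_pow_thomaMeasure (ω : ThomaSimplex) (l : ℕ) :
    ∫ x, (x : ℝ) ^ l ∂(thomaMeasure ω) = extPowerSum (l + 1) ω := by
  have integrable_pow : Integrable (fun x : Set.Icc (-1 : ℝ) 1 => (x : ℝ) ^ l) (thomaMeasure ω) :=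
    .of_bound (Continuous.aestronglyMeasurable (by fun_prop)) 1 (.of_forall (abs_pow_le_one · l))
  obtain ⟨integrable_αβ, integrable_γ⟩ := integrable_add_measure.1 integrable_pow
  obtain ⟨integrable_α, integrable_β⟩ := integrable_add_measure.1 integrable_αβ
  rw [thomaMeasure, integral_add_measure integrable_αβ integrable_γ,
    integral_add_measure integrable_α integrable_β, integral_sum_measure integrable_α,
    integral_sum_measure integrable_β]
  simp only [integral_smul_measure, integral_dirac, smul_eq_mul,
    ENNReal.toReal_ofReal (ω.α_nonneg _), ENNReal.toReal_ofReal (ω.β_nonneg _),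
    ENNReal.toReal_ofReal ω.γ_nonneg, posPoint, negPoint]
  rcases Nat.eq_zero_or_pos l with rfl | hl
  · simp [extPowerSum]
  · rw [extPowerSum, if_neg (by omega), zero_pow hl.ne', mul_zero, add_zero, Nat.add_sub_cancel,
      ← tsum_mul_left]
    congr 1
    · exact tsum_congr fun i => (pow_succ' _ _).symm
    · refine tsum_congr fun i => ?_
      rw [neg_pow, pow_succ]
      ring

theorem integral_prod_pow_pi_thomaMeasure {ι : Type*} [Fintype ι] (ω : ThomaSimplex) (l : ι → ℕ) :
    ∫ x, ∏ i, (x i : ℝ) ^ l i ∂(Measure.pi fun _ => thomaMeasure ω) =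
      ∏ i, extPowerSum (l i + 1) ω := by
  have integral_prod := integral_fintype_prod_eq_prod (𝕜 := ℝ) (μ := fun _ : ι => thomaMeasure ω)
    fun i (x : Set.Icc (-1 : ℝ) 1) => (x : ℝ) ^ l i
  simpa only [integral_pow_thomaMeasure] using integral_prod

theorem abs_extPowerSum_succ_le_one (k : ℕ) (ω : ThomaSimplex) : |extPowerSum (k + 1) ω| ≤ 1 := by
  rw [← integral_pow_thomaMeasure]
  simpa using norm_integral_le_of_norm_le_const (μ := thomaMeasure ω) (C := 1)
    (f := fun x => (x : ℝ) ^ k) (.of_forall (abs_pow_le_one · k))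

theorem measurable_extPowerSum_succ (k : ℕ) :
    Measurable fun ω : ThomaSimplex => extPowerSum (k + 1) ω := by
  simp only [← integral_pow_thomaMeasure]
  have measurable_pow : Measurable fun x : Set.Icc (-1 : ℝ) 1 => (x : ℝ) ^ k :=
    measurable_subtype_coe.pow_const k
  exact (measurable_pow.stronglyMeasurable.integral_kernel (κ := thomaKernel)).measurable

theorem integrable_extend (P : Measure ThomaSimplex) [IsFiniteMeasure P] (f : SymFun) :
    Integrable (extend f) P := by
  unfold extend
  induction f using MvPolynomial.induction_on with
  | C a => simp only [MvPolynomial.aeval_C, integrable_const]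
  | add p q hp hq => simpa only [map_add, Pi.add_def] using hp.add hq
  | mul_X p k hp =>
    simp only [map_mul, MvPolynomial.aeval_X]
    exact hp.mul_bdd (measurable_extPowerSum_succ k).aestronglyMeasurable
      (.of_forall (abs_extPowerSum_succ_le_one k))

theorem integral_prod_pow_controllingMeasure (P : Measure ThomaSimplex) [IsFiniteMeasure P]
    (n : ℕ) (l : Fin n → ℕ) : ∫ x, ∏ i, (x i : ℝ) ^ l i ∂(controllingMeasure P n) =
      ∫ ω, ∏ i, extPowerSum (l i + 1) ω ∂P := by
  have controllingMeasure_eq :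
      controllingMeasure P n = (thomaPowKernel n ∘ₖ Kernel.const Unit P) () :=
    Measure.comp_eq_comp_const_apply (κ := thomaPowKernel n)
  have abs_prod_pow_le_one (x : Fin n → Set.Icc (-1 : ℝ) 1) : |∏ i, (x i : ℝ) ^ l i| ≤ 1 := by
    rw [Finset.abs_prod]
    exact Finset.prod_le_one (fun _ _ => abs_nonneg _) fun i _ => abs_pow_le_one (x i) (l i)
  rw [controllingMeasure_eq, Kernel.integral_comp, Kernel.const_apply]
  · exact integral_congr_ae (.of_forall fun ω => integral_prod_pow_pi_thomaMeasure ω l)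
  · exact .of_bound (Continuous.aestronglyMeasurable (by fun_prop)) 1
      (.of_forall abs_prod_pow_le_one)

end ThomaSimplex

/-! ### Determinacy of the moment problem on a cube -/

section Cube

open BoundedContinuousFunction

variable {ι : Type*} {a b : ℝ}

/-- The `i`-th coordinate of the cube `[a, b]^ι`, as a bounded continuous function. -/
def cubeCoordinate (i : ι) : (ι → Set.Icc a b) →ᵇ ℝ :=
  mkOfCompact ⟨fun x => (x i : ℝ), by fun_prop⟩

/-- The algebra of polynomial functions on the cube `[a, b]^ι`, as a star subalgebra for the
Stone–Weierstrass theorem. -/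
def cubePolynomials (ι : Type*) (a b : ℝ) :
    StarSubalgebra ℝ ((ι → Set.Icc a b) →ᵇ ℝ) :=
  { (MvPolynomial.aeval (R := ℝ) (cubeCoordinate (ι := ι) (a := a) (b := b))).range with
    star_mem' := fun {f} hf => (show star f = f from ext fun _ => star_trivial _).symm ▸ hf }

theorem separatesPoints_cubePolynomials :
    ((cubePolynomials ι a b).map (toContinuousMapStarₐ ℝ)).SeparatesPoints := by
  intro x y hxy
  obtain ⟨i, hi⟩ := Function.ne_iff.1 hxy
  exact ⟨_, ⟨_, ⟨cubeCoordinate i, ⟨MvPolynomial.X i, MvPolynomial.aeval_X _ i⟩, rfl⟩, rfl⟩,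
    Subtype.coe_injective.ne hi⟩

theorem aeval_cubeCoordinate_apply (p : MvPolynomial ι ℝ) (x : ι → Set.Icc a b) :
    MvPolynomial.aeval cubeCoordinate p x = MvPolynomial.eval (fun i => (x i : ℝ)) p := by
  induction p using MvPolynomial.induction_on with
  | C r => simp
  | add p q hp hq => simp [hp, hq]
  | mul_X p i hp => simp [hp, cubeCoordinate]

theorem eq_of_forall_integral_prod_pow_eq [Fintype ι] {μ ν : Measure (ι → Set.Icc a b)}
    [IsFiniteMeasure μ] [IsFiniteMeasure ν]
    (h : ∀ l : ι → ℕ, ∫ x, ∏ i, (x i : ℝ) ^ l i ∂μ = ∫ x, ∏ i, (x i : ℝ) ^ l i ∂ν) :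
    μ = ν := by
  refine ext_of_forall_mem_subalgebra_integral_eq_of_polish separatesPoints_cubePolynomials ?_
  rintro _ ⟨p, rfl⟩
  change ∫ x, MvPolynomial.aeval cubeCoordinate p x ∂μ =
    ∫ x, MvPolynomial.aeval cubeCoordinate p x ∂ν
  induction p using MvPolynomial.induction_on' with
  | monomial m r =>
    simp only [aeval_cubeCoordinate_apply, MvPolynomial.eval_monomial,
      Finsupp.prod_fintype _ _ fun _ => pow_zero _, integral_const_mul, h]
  | add p q hp hq =>
    simp only [map_add, coe_add, Pi.add_apply]
    rw [integral_add (integrable μ _) (integrable μ _),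
      integral_add (integrable ν _) (integrable ν _), hp, hq]

end Cube

/-! ### The Frobenius formula -/

namespace SymmetricGroup

open SymFun YoungGraph

variable {lam : YoungDiagram} {s : Multiset ℕ}

theorem irrCharAt_eq_pairing (hpos : ∀ r ∈ s, 0 < r) (hsum : s.sum = lam.card) :
    irrCharAt lam s = pairing (schur lam) (MvPolynomial.monomial (powerExp s) 1) := by
  obtain ⟨g, rfl⟩ := exists_partition_parts_eq hpos (hsum.trans (Fintype.card_coe lam.cells).symm)
  rw [irrCharAt_eq, ← charMap_irrChar]
  exact (pairing_charMap_cycleMonomial irrChar_eq_of_isConj g).symm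

theorem irrCharAt_eq_zero_of_card_lt_diagLen (hpos : ∀ r ∈ s, 0 < r) (hsum : s.sum = lam.card)
    (h : s.card < diagLen lam) : irrCharAt lam s = 0 := by
  rw [irrCharAt_eq_pairing hpos hsum]
  exact pairing_schur_monomial_of_degree_lt ((degree_powerExp s).trans_lt h)

theorem prod_X_eq_sum_irrCharAt_smul_schur (hpos : ∀ r ∈ s, 0 < r) :
    (s.map fun r => (MvPolynomial.X (r - 1) : SymFun)).prod =
      ∑ lam ∈ level s.sum with diagLen lam ≤ s.card, irrCharAt lam s • schur lam := by
  rw [← monomial_powerExp, eq_sum_pairing_schur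
    (MvPolynomial.isWeightedHomogeneous_monomial _ _ _ (wt_powerExp hpos)), Finset.sum_filter]
  refine Finset.sum_congr rfl fun lam hlam => ?_
  have hsum : s.sum = lam.card := (mem_level.1 hlam).symm
  rw [← irrCharAt_eq_pairing hpos hsum]
  split_ifs with hdiag
  · rfl
  · rw [irrCharAt_eq_zero_of_card_lt_diagLen hpos hsum (not_le.1 hdiag), zero_smul]

end SymmetricGroup

namespace ThomaSimplex

open SymmetricGroup YoungGraph

theorem prod_extPowerSum_eq_sum_irrCharAt_mul_extend {s : Multiset ℕ} (hpos : ∀ r ∈ s, 0 < r)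
    (ω : ThomaSimplex) : (s.map fun r => extPowerSum r ω).prod =
      ∑ lam ∈ level s.sum with diagLen lam ≤ s.card,
        irrCharAt lam s * extend (SymFun.schur lam) ω := by
  have frobenius := congrArg (extend · ω) (prod_X_eq_sum_irrCharAt_smul_schur hpos)
  simp only [extend, map_multiset_prod, Multiset.map_map, Function.comp_apply,
    MvPolynomial.aeval_X, map_sum, map_smul, smul_eq_mul] at frobenius
  have sub_add_one : ∀ r ∈ s, extPowerSum (r - 1 + 1) ω = extPowerSum r ω := fun r hr => by
    rw [Nat.sub_add_cancel (hpos r hr)]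
  rwa [Multiset.map_congr rfl sub_add_one] at frobenius

theorem integral_prod_extPowerSum {M : YoungDiagram → ℝ} {P : Measure ThomaSimplex}
    (hP : IsSpectralMeasure M P) {n : ℕ} (l : Fin n → ℕ) :
    ∫ ω, ∏ i, extPowerSum (l i + 1) ω ∂P =
      ∑ lam ∈ level ((∑ i, l i) + n) with diagLen lam ≤ n,
        irrCharAt lam (Finset.univ.val.map fun i => l i + 1) * (M lam / (dim lam : ℝ)) := by
  have := hP.isProb
  set s : Multiset ℕ := Finset.univ.val.map fun i => l i + 1 with hs
  have s_pos : ∀ r ∈ s, 0 < r := by simp [hs]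
  have s_card : s.card = n := by simp [hs]
  have s_sum : s.sum = (∑ i, l i) + n :=
    (Finset.sum_add_distrib (f := l) (g := fun _ => 1)).trans (by simp)
  have prod_eq (ω : ThomaSimplex) :
      ∏ i, extPowerSum (l i + 1) ω = (s.map fun r => extPowerSum r ω).prod := by
    rw [hs, Multiset.map_map]
    rfl
  simp only [prod_eq, prod_extPowerSum_eq_sum_irrCharAt_mul_extend s_pos, s_card, s_sum]
  rw [integral_finsetSum _ fun lam _ => (integrable_extend P _).const_mul _]
  simp only [integral_const_mul, hP.repr]

end ThomaSimplex

end

theorem proposition3p2 (M : YoungDiagram → ℝ) (hM : YoungGraph.IsCoherentSystem M)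
    (P : MeasureTheory.Measure ThomaSimplex) (hP : IsSpectralMeasure M P) (n : ℕ) :
    MeasureTheory.IsProbabilityMeasure (ThomaSimplex.controllingMeasure P n) ∧
    (∀ l : Fin n → ℕ,
      ∫ x, ∏ i, (x i : ℝ) ^ l i ∂(ThomaSimplex.controllingMeasure P n)
          = ∫ ω, ∏ i, ThomaSimplex.extPowerSum (l i + 1) ω ∂P ∧
      ∫ ω, ∏ i, ThomaSimplex.extPowerSum (l i + 1) ω ∂P
          = ∑ lam ∈ (YoungGraph.level ((∑ i, l i) + n)).filter
                (fun lam => YoungGraph.diagLen lam ≤ n),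
              SymmetricGroup.irrCharAt lam (Finset.univ.val.map fun i => l i + 1)
                * (M lam / (YoungGraph.dim lam : ℝ))) ∧
    (∀ (M' : YoungDiagram → ℝ) (P' : MeasureTheory.Measure ThomaSimplex),
      YoungGraph.IsCoherentSystem M' → IsSpectralMeasure M' P' →
      (∀ lam : YoungDiagram, YoungGraph.diagLen lam ≤ n → M' lam = M lam) →
      ThomaSimplex.controllingMeasure P' n = ThomaSimplex.controllingMeasure P n) := by
  have := hP.isProb
  refine ⟨inferInstance, fun l => ⟨ThomaSimplex.integral_prod_pow_controllingMeasure P n l,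
    ThomaSimplex.integral_prod_extPowerSum hP l⟩, fun M' P' _ hP' hMM' => ?_⟩
  have := hP'.isProb
  refine eq_of_forall_integral_prod_pow_eq fun l => ?_
  rw [ThomaSimplex.integral_prod_pow_controllingMeasure,
    ThomaSimplex.integral_prod_pow_controllingMeasure,
    ThomaSimplex.integral_prod_extPowerSum hP, ThomaSimplex.integral_prod_extPowerSum hP']
  refine Finset.sum_congr rfl fun lam hlam => ?_
  rw [hMM' lam (Finset.mem_filter.1 hlam).2]
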